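/- Let $N\ge 0$ and let $U:\mathbb R^N\to\mathbb R$ be a homogeneous quartic polynomial satisfying the weak growth condition: there is a constant $C_U$ with $U(x)+C_U(1+\|x\|^2)\ge 0$ for all $x$, and the set of symmetric matrices $A$ with $\int_{\mathbb R^N} e^{-\frac12x^TAx-U(x)}\,dx<\infty$ is open in the space of symmetric $N\times N$ real matrices. For a symmetric positive definite $G$ and an interaction $V$ put $$\mathcal F[G,V]=\sup_{\mu}\Big[H(\mu)-\int V\,d\mu\Big],\qquad \Phi[G,V]=2\mathcal F[G,V]-\mathrm{Tr}[\log G]-N\log(2\pi e),$$ where the supremum is over the probability measures $\mu$ on $\mathbb R^N$ with finite second moments and $\int xx^T\,d\mu=G$, and $H(\mu)$ is the differential entropy ($H(\mu)=-\int\log\frac{d\mu}{dx}\,d\mu$ if $\mu$ has a density, $-\infty$ otherwise). Let $\Sigma[G,V]=\frac12\nabla_G\Phi[G,V]$, where $(\nabla f)_{ij}(G)=\lim_{\delta\to0}\delta^{-1}\big(f(G+\delta E^{(ij)})-f(G)\big)$ and $E^{(ij)}_{kl}=\delta_{ik}\delta_{jl}+\delta_{il}\delta_{jk}$. Then $\mathcal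 F[G,\varepsilon U]$ is finite for all symmetric positive definite $G$ and all $\varepsilon>0$. Moreover, for every symmetric positive definite $G$, the functional $\Phi[\,\cdot\,,\varepsilon U]$ is differentiable at $G$ (as a function of symmetric matrices) for all sufficiently small $\varepsilon>0$, and $\Phi[G,\varepsilon U]$ and $\Sigma[G,\varepsilon U]$ have asymptotic series $$\Phi[G,\varepsilon U]\sim\sum_{k\ge1}\Phi^{(k)}_G\varepsilon^k,\qquad \Sigma[G,\varepsilon U]\sim\sum_{k\ge1}\Sigma^{(k)}_G\varepsilon^k\qquad(\varepsilon\to0^+),$$ in the sense that for every $M\ge0$ the error of the $M$-th partial sum is $O(\varepsilon^{M+1})$. Their (necessarily unique) coefficients satisfy, for every $k\ge1$, $$\Phi^{(k)}_G=\frac1{2k}\,\mathrm{Tr}\big[G\,\Sigma^{(k)}_G\big].$$ -/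

import Mathlib

open MeasureTheory Filter Topology Asymptotics
open scoped ENNReal Matrix

noncomputable section

namespace LuttingerWard

/-- The partition function `Z[A, U] = ∫ exp (-xᵀAx / 2 - U x) dx`, possibly infinite. -/
def partitionFunction {N : ℕ} (A : Matrix (Fin N) (Fin N) ℝ) (U : (Fin N → ℝ) → ℝ) : ℝ≥0∞ :=
  ∫⁻ x : Fin N → ℝ, ENNReal.ofReal (Real.exp (-(1 / 2) * (x ⬝ᵥ (A *ᵥ x)) - U x))

/-- The free energy `Ω[A, U] = -log Z[A, U]`, which is `-∞` exactly when the integral diverges. -/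
def freeEnergy {N : ℕ} (A : Matrix (Fin N) (Fin N) ℝ) (U : (Fin N → ℝ) → ℝ) : EReal :=
  -ENNReal.log (partitionFunction A U)

/-- The weak growth condition on an interaction `U`: at most quadratic decay to `-∞`, and the
domain `{A | Ω[A, U] > -∞}` is open in the space of symmetric matrices.
Here `x ⬝ᵥ x` is the squared Euclidean norm. -/
structure WeakGrowth {N : ℕ} (U : (Fin N → ℝ) → ℝ) : Prop where
  measurable : Measurable U
  lower_bound : ∃ C : ℝ, ∀ x : Fin N → ℝ, 0 ≤ U x + C * (1 + x ⬝ᵥ x)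
  isOpen_dom : IsOpen {A : {A : Matrix (Fin N) (Fin N) ℝ // A.IsSymm} | ⊥ < freeEnergy A.1 U}

/-- The Lebesgue integral with values in `[-∞, ∞]`: integral of the positive part minus integral
of the negative part. It is used only where at most one of the two is infinite. -/
def extIntegral {N : ℕ} (μ : Measure (Fin N → ℝ)) (f : (Fin N → ℝ) → ℝ) : EReal :=
  ((∫⁻ x, ENNReal.ofReal (f x) ∂μ : ℝ≥0∞) : EReal)
    - ((∫⁻ x, ENNReal.ofReal (-f x) ∂μ : ℝ≥0∞) : EReal)

open Classical in
/-- The differential entropy `H(μ) = -∫ log (dμ/dx) dμ` if `μ` is absolutely continuous with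
respect to Lebesgue measure, and `-∞` otherwise. For a probability measure with finite second
moments the integral is well defined with values in `[-∞, ∞)`. -/
def entropy {N : ℕ} (μ : Measure (Fin N → ℝ)) : EReal :=
  if μ ≪ volume then extIntegral μ (fun x => -Real.log ((μ.rnDeriv volume x).toReal)) else ⊥

/-- The probability measures with finite second moments whose second-order moment matrix
`∫ x xᵀ dμ` is `G`. -/
def momentFiber {N : ℕ} (G : Matrix (Fin N) (Fin N) ℝ) : Set (Measure (Fin N → ℝ)) :=
  {μ | IsProbabilityMeasure μ ∧ (∀ i, Integrable (fun x => x i ^ 2) μ) ∧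
    ∀ i j, ∫ x, x i * x j ∂μ = G i j}

/-- `ℱ[G, U] = sup {H(μ) - ∫ U dμ}` over the probability measures `μ` with finite second moments
and second-order moment matrix `G`. -/
def dualFunctional {N : ℕ} (G : Matrix (Fin N) (Fin N) ℝ) (U : (Fin N → ℝ) → ℝ) : EReal :=
  ⨆ μ ∈ momentFiber G, (entropy μ - extIntegral μ U)

/-- The Luttinger-Ward functional `Φ[G, U] = 2 ℱ[G, U] - Tr (log G) - N log (2πe)`. -/
def lwFunctional {N : ℕ} (G : Matrix (Fin N) (Fin N) ℝ) (U : (Fin N → ℝ) → ℝ) : ℝ :=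
  2 * (dualFunctional G U).toReal - (cfc Real.log G).trace
    - N * Real.log (2 * Real.pi * Real.exp 1)

/-- The symmetric matrix `E^{(ij)}` with `E^{(ij)}_{kl} = δ_ik δ_jl + δ_il δ_jk`. -/
def symUnit {N : ℕ} (i j : Fin N) : Matrix (Fin N) (Fin N) ℝ :=
  Matrix.single i j 1 + Matrix.single j i 1

/-- The self-energy `Σ[G, U] = (1/2) ∇Φ[G, U]`, where `∇_ij` is the directional derivative along
`E^{(ij)}`. -/
def selfEnergy {N : ℕ} (G : Matrix (Fin N) (Fin N) ℝ) (U : (Fin N → ℝ) → ℝ) :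
    Matrix (Fin N) (Fin N) ℝ :=
  Matrix.of fun i j => (1 / 2) * deriv (fun δ : ℝ => lwFunctional (G + δ • symUnit i j) U) 0

/-- `f ε ~ ∑_{k ≥ 1} c k * ε ^ k` as `ε → 0⁺`: for every `M` the error of the `M`-th partial sum
is `O(ε ^ (M + 1))`. (The value `c 0` plays no role.) -/
def IsAsymptoticSeries (f : ℝ → ℝ) (c : ℕ → ℝ) : Prop :=
  ∀ M : ℕ, (fun ε : ℝ => f ε - ∑ k ∈ Finset.Icc 1 M, c k * ε ^ k)
    =O[𝓝[>] 0] (fun ε : ℝ => ε ^ (M + 1))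

end LuttingerWard

end

/-! Write ε = s² and consider the Gibbs densities proportional to exp(-xᵀAx/2 - s²p(x)) with A
coercive. Quartic homogeneity and the lower growth bound force p ≥ 0
(`eval_nonneg_of_isHomogeneous`), so all moments of these weights converge and are smooth in (A, s),
across s = 0 as well (`contDiffOn_moment`).

Gibbs' inequality gives ℱ[G, s²p] ≤ ½ Tr[AG] + log Z(A, s) for every such symmetric A, with equality
when the Gibbs measure of (A, s) has second moments G (`dualFunctional_le`,
`dualFunctional_secondMoment`). At s = 0 the measures are Gaussian and the moment map on symmetric A
is A ↦ A⁻¹; the inverse function theorem then yields a smooth solution A = B(G, s) near s = 0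
(`exists_inverse_momentMap`). The functionals ½B(·, s) support ℱ from above and vary continuously,
so they are its gradient (`hasFDerivWithinAt_dualReal`). Since Φ is twice the difference of ℱ at
couplings s and 0 (`lwFunctional_eq`), Σ = B(G, s) - G⁻¹. This is smooth in s and a function of s²
alone, so it has a series in ε.

The coefficients come from dilations. Replacing x by rx shows Φ[r²G, s²p] = Φ[G, r⁴s²p] wherever a
Gibbs measure realizes the moments (`lwFunctional_scaling`), so the derivative of Φ in ε is its
derivative in the direction G, divided by 2ε: ∂Φ/∂ε = Tr[GΣ]/(2ε). As Φ → 0 when ε → 0⁺, the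
expansion of Σ can be integrated term by term (`IsAsymptoticSeries.of_hasDerivAt`), which produces
the factor 1/(2k); coefficients of asymptotic series are unique. -/

noncomputable section

namespace LuttingerWard

open MvPolynomial (eval)

variable {N : ℕ}

/-! ### Moments of quartic weights -/

/-- The quadratic form of an array of coefficients. -/
def quad (A : Fin N → Fin N → ℝ) (x : Fin N → ℝ) : ℝ := ∑ i, ∑ j, A i j * (x i * x j)

/-- The arrays whose quadratic form is bounded below by a positive multiple of `∑ i, x i ^ 2`. -/
def coercive (N : ℕ) : Set (Fin N → Fin N → ℝ) :=
  {A | ∃ c > 0, ∀ x, c * ∑ i, x i ^ 2 ≤ quad A x}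

/-- The weight `exp (-xᵀAx / 2 - s² p(x))` at `e = (A, s)`. Writing the coupling as a square makes
it smooth in `s` across `s = 0`. -/
def weight (p : MvPolynomial (Fin N) ℝ) (e : (Fin N → Fin N → ℝ) × ℝ) (x : Fin N → ℝ) : ℝ :=
  Real.exp (-(1 / 2) * quad e.1 x - e.2 ^ 2 * eval x p)

/-- The unnormalized moment of the polynomial `q`. -/
def moment (p q : MvPolynomial (Fin N) ℝ) (e : (Fin N → Fin N → ℝ) × ℝ) : ℝ :=
  ∫ x, eval x q * weight p e x

lemma integrable_eval_mul_exp (q : MvPolynomial (Fin N) ℝ) {c : ℝ} (hc : 0 < c) :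
    Integrable (fun x : Fin N → ℝ => eval x q * Real.exp (-c * ∑ i, x i ^ 2)) := by
  have h (m : Fin N →₀ ℕ) : Integrable (fun x : Fin N → ℝ =>
      ∏ i, (x i ^ m i * Real.exp (-c * x i ^ 2))) := by
    refine Integrable.fintype_prod (f := fun i t => t ^ m i * Real.exp (-c * t ^ 2)) fun i => ?_
    have := integrable_rpow_mul_exp_neg_mul_sq hc (s := (m i : ℝ))
      (by have : (0 : ℝ) ≤ m i := Nat.cast_nonneg _; linarith)
    simpa [Real.rpow_natCast] using this
  have h2 : (fun x : Fin N → ℝ => eval x q * Real.exp (-c * ∑ i, x i ^ 2)) = fun x =>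
      ∑ m ∈ q.support, q.coeff m * ∏ i, (x i ^ m i * Real.exp (-c * x i ^ 2)) := by
    funext x
    rw [MvPolynomial.eval_eq', Finset.sum_mul, Finset.mul_sum, Real.exp_sum]
    simp only [Finset.prod_mul_distrib, mul_assoc]
  rw [h2]
  exact integrable_finsetSum _ fun m _ => (h m).const_mul _

lemma abs_quad_le (A : Fin N → Fin N → ℝ) (x : Fin N → ℝ) :
    |quad A x| ≤ ‖A‖ * (N * ∑ i, x i ^ 2) := by
  have h1 : ∀ i j, |A i j * (x i * x j)| ≤ ‖A‖ * ((x i ^ 2 + x j ^ 2) / 2) := fun i j => by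
    rw [abs_mul]
    gcongr
    · exact (norm_le_pi_norm (A i) j).trans (norm_le_pi_norm A i)
    · rw [abs_mul, ← sq_abs (x i), ← sq_abs (x j)]
      nlinarith [sq_nonneg (|x i| - |x j|)]
  calc |quad A x| ≤ ∑ i, ∑ j, ‖A‖ * ((x i ^ 2 + x j ^ 2) / 2) :=
        (Finset.abs_sum_le_sum_abs _ _).trans <| Finset.sum_le_sum fun i _ =>
          (Finset.abs_sum_le_sum_abs _ _).trans <| Finset.sum_le_sum fun j _ => h1 i j
    _ = ‖A‖ * (N * ∑ i, x i ^ 2) := by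
        simp only [← Finset.mul_sum, ← Finset.sum_div, Finset.sum_add_distrib, Finset.sum_const,
          Finset.card_univ, Fintype.card_fin, nsmul_eq_mul]
        ring

lemma quad_sub (A B : Fin N → Fin N → ℝ) (x : Fin N → ℝ) :
    quad (A - B) x = quad A x - quad B x := by
  simp [quad, sub_mul, Finset.sum_sub_distrib]

lemma quad_smul (A : Fin N → Fin N → ℝ) (t : ℝ) (x : Fin N → ℝ) :
    quad A (t • x) = t ^ 2 * quad A x := by
  simp only [quad, Pi.smul_apply, smul_eq_mul, Finset.mul_sum]
  exact Finset.sum_congr rfl fun i _ => Finset.sum_congr rfl fun j _ => by ring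

lemma exists_ball_coercive {A : Fin N → Fin N → ℝ} (hA : A ∈ coercive N) :
    ∃ c > 0, ∃ r > 0, ∀ B ∈ Metric.ball A r, ∀ x, c * ∑ i, x i ^ 2 ≤ quad B x := by
  obtain ⟨c, hc, h⟩ := hA
  -- The radius makes the perturbation bound `‖B - A‖ * N` at most `c / 2`; `N + 1` avoids division
  -- by zero when `N = 0`.
  refine ⟨c / 2, by positivity, c / (2 * (N + 1)), by positivity, fun B hB x => ?_⟩
  have h1 := abs_quad_le (B - A) x
  rw [quad_sub] at h1
  have hS : 0 ≤ ∑ i, x i ^ 2 := Finset.sum_nonneg fun i _ => sq_nonneg _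
  have h2 : ‖B - A‖ * (N * ∑ i, x i ^ 2) ≤ c / 2 * ∑ i, x i ^ 2 := by
    rw [Metric.mem_ball, dist_eq_norm] at hB
    calc ‖B - A‖ * (N * ∑ i, x i ^ 2)
        ≤ c / (2 * (N + 1)) * ((N + 1) * ∑ i, x i ^ 2) := by gcongr; linarith
      _ = _ := by field_simp
  linarith [neg_abs_le (quad B x - quad A x), h x]

lemma isOpen_coercive : IsOpen (coercive N) := by
  refine Metric.isOpen_iff.2 fun A hA => ?_
  obtain ⟨c, hc, r, hr, h⟩ := exists_ball_coercive hA
  exact ⟨r, hr, fun B hB => ⟨c, hc, h B hB⟩⟩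

lemma continuous_eval (q : MvPolynomial (Fin N) ℝ) : Continuous fun x : Fin N → ℝ => eval x q :=
  MvPolynomial.continuous_eval q

lemma continuous_quad (A : Fin N → Fin N → ℝ) : Continuous (quad A) := by
  unfold quad; fun_prop

lemma continuous_weight (p : MvPolynomial (Fin N) ℝ) (e : (Fin N → Fin N → ℝ) × ℝ) :
    Continuous (weight p e) := by
  have := continuous_eval p
  have := continuous_quad e.1
  unfold weight; fun_prop

lemma weight_pos (p : MvPolynomial (Fin N) ℝ) (e : (Fin N → Fin N → ℝ) × ℝ) (x : Fin N → ℝ) :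
    0 < weight p e x := Real.exp_pos _

variable {p : MvPolynomial (Fin N) ℝ}

lemma weight_le (hp : ∀ x, 0 ≤ eval x p) {e : (Fin N → Fin N → ℝ) × ℝ} {c : ℝ}
    (h : ∀ x, c * ∑ i, x i ^ 2 ≤ quad e.1 x) (x : Fin N → ℝ) :
    weight p e x ≤ Real.exp (-(c / 2) * ∑ i, x i ^ 2) := by
  refine Real.exp_le_exp.2 ?_
  have := mul_nonneg (sq_nonneg e.2) (hp x)
  linarith [h x]

lemma integrable_eval_mul_weight (hp : ∀ x, 0 ≤ eval x p) (q : MvPolynomial (Fin N) ℝ)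
    {e : (Fin N → Fin N → ℝ) × ℝ} (he : e.1 ∈ coercive N) :
    Integrable (fun x => eval x q * weight p e x) := by
  obtain ⟨c, hc, h⟩ := he
  refine (integrable_eval_mul_exp q (half_pos hc)).mono
    ((continuous_eval q).mul (continuous_weight p e)).aestronglyMeasurable
    (ae_of_all _ fun x => ?_)
  rw [norm_mul, norm_mul, Real.norm_of_nonneg (weight_pos p e x).le,
    Real.norm_of_nonneg (Real.exp_pos _).le]
  gcongr
  exact weight_le hp h x

lemma integrable_weight (hp : ∀ x, 0 ≤ eval x p) {e : (Fin N → Fin N → ℝ) × ℝ}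
    (he : e.1 ∈ coercive N) : Integrable (weight p e) := by
  simpa using integrable_eval_mul_weight hp 1 he

lemma moment_one_pos (hp : ∀ x, 0 ≤ eval x p) {e : (Fin N → Fin N → ℝ) × ℝ}
    (he : e.1 ∈ coercive N) : 0 < moment p 1 e := by
  have h := integrable_weight hp he
  simp only [moment, map_one, one_mul]
  rw [integral_pos_iff_support_of_nonneg (fun x => (weight_pos p e x).le) h]
  have : Function.support (weight p e) = Set.univ :=
    Set.eq_univ_of_forall fun x => (weight_pos p e x).ne'
  rw [this]
  exact isOpen_univ.measure_pos _ Set.univ_nonempty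

/-- The coordinate functional `(A, s) ↦ A i j`. -/
def entryL (i j : Fin N) : (Fin N → Fin N → ℝ) × ℝ →L[ℝ] ℝ :=
  (ContinuousLinearMap.proj j).comp
    ((ContinuousLinearMap.proj (R := ℝ) (φ := fun _ : Fin N => Fin N → ℝ) i).comp
      (ContinuousLinearMap.fst ℝ _ ℝ))

@[simp] lemma entryL_apply (i j : Fin N) (e : (Fin N → Fin N → ℝ) × ℝ) :
    entryL i j e = e.1 i j := rfl

lemma hasFDerivAt_weight (p : MvPolynomial (Fin N) ℝ) (e : (Fin N → Fin N → ℝ) × ℝ)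
    (x : Fin N → ℝ) :
    HasFDerivAt (fun e => weight p e x)
      (weight p e x • (-(1 / 2 : ℝ) • ∑ i, ∑ j, (x i * x j) • entryL i j
        - (2 * e.2 * eval x p) • ContinuousLinearMap.snd ℝ _ ℝ)) e := by
  have h1 : HasFDerivAt (fun e : (Fin N → Fin N → ℝ) × ℝ => quad e.1 x)
      (∑ i, ∑ j, (x i * x j) • entryL i j) e := by
    have : (fun e : (Fin N → Fin N → ℝ) × ℝ => quad e.1 x) =
        ⇑(∑ i, ∑ j, (x i * x j) • entryL (N := N) i j) := by
      funext e
      simp [quad, mul_comm]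
    rw [this]
    exact ContinuousLinearMap.hasFDerivAt _
  have h2 : HasFDerivAt (fun e : (Fin N → Fin N → ℝ) × ℝ => e.2 ^ 2 * eval x p)
      ((2 * e.2 * eval x p) • ContinuousLinearMap.snd ℝ _ ℝ) e := by
    have h3 : HasFDerivAt (fun e : (Fin N → Fin N → ℝ) × ℝ => e.2)
      (ContinuousLinearMap.snd ℝ _ ℝ) e := hasFDerivAt_snd
    refine ((h3.pow 2).mul_const (eval x p)).congr_fderiv ?_
    rw [smul_smul]
    congr 1
    simp; ring
  exact ((h1.const_mul (-(1 / 2 : ℝ))).sub h2).exp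

/-- The derivative of a moment is a combination of moments. -/
lemma hasFDerivAt_moment (hp : ∀ x, 0 ≤ eval x p) (q : MvPolynomial (Fin N) ℝ)
    {e : (Fin N → Fin N → ℝ) × ℝ} (he : e.1 ∈ coercive N) :
    HasFDerivAt (moment p q)
      (∑ i, ∑ j, (-(1 / 2) * moment p (q * (.X i * .X j)) e) • entryL i j
        - (2 * e.2 * moment p (q * p) e) • ContinuousLinearMap.snd ℝ _ ℝ) e := by
  obtain ⟨c, hc, r, hr, hball⟩ := exists_ball_coercive he
  set F' : (Fin N → Fin N → ℝ) × ℝ → (Fin N → ℝ) → ((Fin N → Fin N → ℝ) × ℝ →L[ℝ] ℝ) :=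
    fun e x => ∑ i, ∑ j, (-(1 / 2) * (eval x (q * (.X i * .X j)) * weight p e x)) • entryL i j
        - (2 * e.2 * (eval x (q * p) * weight p e x)) • ContinuousLinearMap.snd ℝ _ ℝ with hF'
  have hint : ∫ x, F' e x = ∑ i, ∑ j, (-(1 / 2) * moment p (q * (.X i * .X j)) e) • entryL i j
        - (2 * e.2 * moment p (q * p) e) • ContinuousLinearMap.snd ℝ _ ℝ := by
    have hi := fun q => integrable_eval_mul_weight hp q he
    rw [hF', integral_sub, integral_finsetSum]
    · congr 1
      · refine Finset.sum_congr rfl fun i _ => ?_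
        rw [integral_finsetSum]
        · refine Finset.sum_congr rfl fun j _ => ?_
          rw [integral_smul_const, integral_const_mul]
          rfl
        · exact fun j _ => ((hi _).const_mul _).smul_const _
      · rw [integral_smul_const, integral_const_mul]
        rfl
    · exact fun i _ => integrable_finsetSum _ fun j _ => ((hi _).const_mul _).smul_const _
    · exact integrable_finsetSum _ fun i _ =>
        integrable_finsetSum _ fun j _ => ((hi _).const_mul _).smul_const _
    · exact ((hi _).const_mul _).smul_const _
  rw [← hint]
  -- Bounds the coupling on the ball of radius at most 1, so that the derivative has one integrable
  -- majorant there.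
  set K := |e.2| + 1
  set g : (Fin N → ℝ) → ℝ := fun x => Real.exp (-(c / 2) * ∑ i, x i ^ 2) with hg
  refine hasFDerivAt_integral_of_dominated_of_fderiv_le (s := Metric.ball e (min r 1))
    (F := fun e x => eval x q * weight p e x) (F' := F')
    (bound := fun x => ∑ i, ∑ j, (1 / 2 * ‖eval x (q * (.X i * .X j)) * g x‖) * ‖entryL i j‖
        + (2 * K * ‖eval x (q * p) * g x‖) *
          ‖ContinuousLinearMap.snd ℝ (Fin N → Fin N → ℝ) ℝ‖)
    (Metric.ball_mem_nhds _ (by positivity)) ?_ (integrable_eval_mul_weight hp q he) ?_ ?_ ?_ ?_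
  · exact Eventually.of_forall fun e =>
      ((continuous_eval q).mul (continuous_weight p e)).aestronglyMeasurable
  · refine Continuous.aestronglyMeasurable ?_
    have := continuous_eval (N := N)
    have := continuous_weight p e
    simp only [hF']
    fun_prop
  · refine ae_of_all _ fun x e' he' => ?_
    have hw : ∀ q, ‖eval x q * weight p e' x‖ ≤ ‖eval x q * g x‖ := fun q => by
      rw [norm_mul, norm_mul, Real.norm_of_nonneg (weight_pos p e' x).le,
        Real.norm_of_nonneg (Real.exp_pos _).le]
      gcongr
      refine weight_le hp (hball e'.1 ?_) x
      have h1 : dist e'.1 e.1 ≤ dist e' e := by rw [Prod.dist_eq]; exact le_max_left _ _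
      exact h1.trans_lt (lt_of_lt_of_le he' (min_le_left r 1))
    have hK : |e'.2| ≤ K := by
      have h1 : dist e'.2 e.2 < 1 :=
        lt_of_le_of_lt (by rw [Prod.dist_eq]; exact le_max_right _ _)
          (lt_of_lt_of_le he' (min_le_right r 1))
      rw [Real.dist_eq] at h1
      have := abs_sub_abs_le_abs_sub e'.2 e.2
      simp only [K]; linarith
    refine (norm_sub_le _ _).trans (add_le_add ?_ ?_)
    · refine (norm_sum_le _ _).trans (Finset.sum_le_sum fun i _ =>
        (norm_sum_le _ _).trans (Finset.sum_le_sum fun j _ => ?_))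
      rw [norm_smul, norm_mul]
      gcongr
      · norm_num
      · exact hw _
    · rw [norm_smul, norm_mul, norm_mul]
      gcongr
      · norm_num
      · exact hK
      · exact hw _
  · have hi := fun q => (integrable_eval_mul_exp (N := N) q (half_pos hc)).norm
    exact (integrable_finsetSum _ fun i _ => integrable_finsetSum _ fun j _ =>
      ((hi _).const_mul _).mul_const _).add (((hi _).const_mul _).mul_const _)
  · refine ae_of_all _ fun x e' _ => ?_
    refine ((hasFDerivAt_weight p e' x).const_mul (eval x q)).congr_fderiv ?_
    simp only [hF', smul_sub, Finset.smul_sum, smul_smul, map_mul, MvPolynomial.eval_X]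
    congr 1
    · refine Finset.sum_congr rfl fun i _ => Finset.sum_congr rfl fun j _ => ?_
      congr 1; ring
    · congr 1; ring

/-- The derivative of a moment is built from moments of other polynomials, so the induction on `n`
must run over all `q` at once. -/
lemma contDiffOn_moment (hp : ∀ x, 0 ≤ eval x p) (q : MvPolynomial (Fin N) ℝ) (n : ℕ) :
    ContDiffOn ℝ n (moment p q) (coercive N ×ˢ Set.univ) := by
  have hO : IsOpen (coercive N ×ˢ (Set.univ : Set ℝ)) := isOpen_coercive.prod isOpen_univ
  induction n generalizing q with
  | zero =>
    exact contDiffOn_zero.2 fun e he =>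
      (hasFDerivAt_moment hp q he.1).continuousAt.continuousWithinAt
  | succ n ih =>
    push_cast
    rw [contDiffOn_succ_iff_fderiv_of_isOpen hO]
    refine ⟨fun e he => (hasFDerivAt_moment hp q he.1).differentiableAt.differentiableWithinAt,
      by simp, ?_⟩
    refine ContDiffOn.congr ?_ fun e he => (hasFDerivAt_moment hp q he.1).fderiv
    refine ContDiffOn.sub (ContDiffOn.sum fun i _ => ContDiffOn.sum fun j _ => ?_) ?_
    · exact (contDiffOn_const.mul (ih _)).smul contDiffOn_const
    · exact ((contDiffOn_const.mul contDiffOn_snd).mul (ih _)).smul contDiffOn_const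

lemma contDiffAt_moment (hp : ∀ x, 0 ≤ eval x p) (q : MvPolynomial (Fin N) ℝ)
    {e : (Fin N → Fin N → ℝ) × ℝ} (he : e.1 ∈ coercive N) :
    ContDiffAt ℝ (⊤ : ℕ∞) (moment p q) e :=
  contDiffAt_infty.2 fun n => (contDiffOn_moment hp q n).contDiffAt
    ((isOpen_coercive.prod isOpen_univ).mem_nhds ⟨he, trivial⟩)

/-! ### Positive definite matrices and Gaussian integrals -/

lemma quad_eq_dotProduct (A : Fin N → Fin N → ℝ) (x : Fin N → ℝ) :
    quad A x = x ⬝ᵥ (Matrix.of A *ᵥ x) := by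
  simp only [quad, dotProduct, Matrix.mulVec, Finset.mul_sum, Matrix.of_apply]
  exact Finset.sum_congr rfl fun i _ => Finset.sum_congr rfl fun j _ => by ring

lemma quad_conj (C B : Matrix (Fin N) (Fin N) ℝ) (x : Fin N → ℝ) :
    quad (Matrix.of.symm C) (B *ᵥ x) = quad (Matrix.of.symm (Bᵀ * C * B)) x := by
  rw [quad_eq_dotProduct, quad_eq_dotProduct, Equiv.apply_symm_apply, Equiv.apply_symm_apply,
    ← Matrix.mulVec_mulVec, ← Matrix.mulVec_mulVec, Matrix.dotProduct_mulVec x,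
    Matrix.vecMul_transpose]

lemma quad_one (x : Fin N → ℝ) : quad (Matrix.of.symm 1) x = ∑ i, x i ^ 2 := by
  rw [quad_eq_dotProduct, Equiv.apply_symm_apply, Matrix.one_mulVec]
  exact Finset.sum_congr rfl fun i _ => (sq _).symm

lemma quad_transpose_mul_self (B : Matrix (Fin N) (Fin N) ℝ) (x : Fin N → ℝ) :
    quad (Matrix.of.symm (Bᵀ * B)) x = ∑ i, (B *ᵥ x) i ^ 2 := by
  rw [← quad_one, quad_conj, Matrix.mul_one]

open scoped MatrixOrder in
lemma exists_transpose_mul_self {A : Matrix (Fin N) (Fin N) ℝ} (hA : A.PosDef) :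
    ∃ B : Matrix (Fin N) (Fin N) ℝ, A = Bᵀ * B ∧ B.det ≠ 0 := by
  have h : A = (CFC.sqrt A)ᵀ * CFC.sqrt A := by
    have h0 : 0 ≤ A := Matrix.nonneg_iff_posSemidef.2 hA.posSemidef
    have h1 : (CFC.sqrt A)ᴴ = CFC.sqrt A :=
      (Matrix.nonneg_iff_posSemidef.1 (CFC.sqrt_nonneg A)).isHermitian
    rw [Matrix.conjTranspose_eq_transpose_of_trivial] at h1
    rw [h1, CFC.sqrt_mul_sqrt_self A h0]
  refine ⟨_, h, fun h0 => ?_⟩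
  have := hA.det_pos
  rw [h, Matrix.det_mul, h0, mul_zero] at this
  exact this.false

lemma coercive_of_posDef {A : Fin N → Fin N → ℝ} (hA : (Matrix.of A).PosDef) :
    A ∈ coercive N := by
  obtain ⟨B, hAB, hB⟩ := exists_transpose_mul_self hA
  obtain rfl : A = Matrix.of.symm (Bᵀ * B) := by rw [← hAB, Equiv.symm_apply_apply]
  have hu : IsUnit B.det := hB.isUnit
  -- Since ∑ xᵢ² is the form of `C` at `B *ᵥ x`, the boundedness of that form gives the coercivity
  -- constant.
  set C : Matrix (Fin N) (Fin N) ℝ := (B⁻¹)ᵀ * B⁻¹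
  have hC : Bᵀ * C * B = 1 := by
    rw [show Bᵀ * C * B = (B⁻¹ * B)ᵀ * (B⁻¹ * B) by
      simp only [C, Matrix.transpose_mul, Matrix.mul_assoc], Matrix.nonsing_inv_mul _ hu]
    simp
  refine ⟨(‖Matrix.of.symm C‖ * N + 1)⁻¹, by positivity, fun x => ?_⟩
  rw [inv_mul_le_iff₀ (by positivity), ← quad_one, ← hC, ← quad_conj, quad_transpose_mul_self B]
  have h1 := (le_abs_self _).trans (abs_quad_le (Matrix.of.symm C) (B *ᵥ x))
  have h2 : 0 ≤ ∑ i, (B *ᵥ x) i ^ 2 := Finset.sum_nonneg fun i _ => sq_nonneg _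
  linarith

lemma posDef_of_coercive {A : Fin N → Fin N → ℝ} (hs : ∀ i j, A i j = A j i)
    (hA : A ∈ coercive N) : (Matrix.of A).PosDef := by
  obtain ⟨c, hc, h⟩ := hA
  refine Matrix.PosDef.of_dotProduct_mulVec_pos ?_ fun x hx => ?_
  · ext i j
    simpa using hs j i
  · rw [star_trivial, ← quad_eq_dotProduct]
    refine lt_of_lt_of_le (mul_pos hc ?_) (h x)
    obtain ⟨i, hi⟩ := Function.ne_iff.1 hx
    exact Finset.sum_pos' (fun i _ => sq_nonneg _) ⟨i, Finset.mem_univ _, by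
      have : x i ≠ 0 := hi
      positivity⟩

lemma moment_zero_coupling (p q : MvPolynomial (Fin N) ℝ) (A : Fin N → Fin N → ℝ) :
    moment p q (A, 0) = ∫ x, eval x q * Real.exp (-(1 / 2) * quad A x) := by
  simp [moment, weight]

/-- The Gaussian integral. -/
lemma moment_one_zero_coupling (p : MvPolynomial (Fin N) ℝ) {A : Fin N → Fin N → ℝ}
    (hA : (Matrix.of A).PosDef) :
    moment p 1 (A, 0) = √(2 * Real.pi) ^ N * (√(Matrix.of A).det)⁻¹ := by
  obtain ⟨B, hAB, hB⟩ := exists_transpose_mul_self hA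
  obtain rfl : A = Matrix.of.symm (Bᵀ * B) := by rw [← hAB, Equiv.symm_apply_apply]
  -- The substitution y = Bx turns the form of `Bᵀ * B` into ∑ yᵢ², and the integral into a product
  -- of one-dimensional Gaussians.
  have h1 : (volume : Measure (Fin N → ℝ)) =
      ENNReal.ofReal |B.det| • Measure.map (Matrix.toLin' B) volume := by
    rw [Real.map_matrix_volume_pi_eq_smul_volume_pi hB, smul_smul, ← ENNReal.ofReal_mul
      (abs_nonneg _), ← abs_mul, mul_inv_cancel₀ hB]
    simp
  have h2 : ∫ x : Fin N → ℝ, Real.exp (-(1 / 2) * ∑ i, x i ^ 2) = √(2 * Real.pi) ^ N := by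
    have := integral_fintype_prod_eq_prod (ι := Fin N) (E := fun _ => ℝ) (𝕜 := ℝ)
      (μ := fun _ => volume) (fun _ t => Real.exp (-(1 / 2) * t ^ 2))
    simp only [integral_gaussian, Finset.prod_const, Finset.card_univ, Fintype.card_fin] at this
    rw [show Real.pi / (1 / 2) = 2 * Real.pi by ring] at this
    rw [← this]
    refine integral_congr_ae (ae_of_all _ fun x => ?_)
    simp only [Finset.mul_sum, Real.exp_sum]
  have h3 : ∫ x : Fin N → ℝ, Real.exp (-(1 / 2) * ∑ i, x i ^ 2) =
      |B.det| * ∫ x : Fin N → ℝ, Real.exp (-(1 / 2) * quad (Matrix.of.symm (Bᵀ * B)) x) := by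
    conv_lhs => rw [h1]
    rw [integral_smul_measure, integral_map, ENNReal.toReal_ofReal (abs_nonneg _), smul_eq_mul]
    · congr 1
      refine integral_congr_ae (ae_of_all _ fun x => ?_)
      simp only [Matrix.toLin'_apply, quad_transpose_mul_self]
    · exact (LinearMap.continuous_of_finiteDimensional _).aemeasurable
    · exact Continuous.aestronglyMeasurable (by fun_prop)
  rw [moment_zero_coupling]
  simp only [map_one, one_mul]
  rw [Equiv.apply_symm_apply, Matrix.det_mul, Matrix.det_transpose, Real.sqrt_mul_self_eq_abs,
    ← h2, h3]
  have := abs_pos.2 hB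
  field_simp

/-- Second moments of a Gaussian. -/
lemma sum_mul_moment_zero_coupling (p : MvPolynomial (Fin N) ℝ) {A : Fin N → Fin N → ℝ}
    (hs : ∀ i j, A i j = A j i) (hA : A ∈ coercive N) (i j : Fin N) :
    ∑ k, A i k * moment p (.X k * .X j) (A, 0) = if i = j then moment p 1 (A, 0) else 0 := by
  set g : (Fin N → ℝ) → ℝ := fun x => Real.exp (-(1 / 2) * quad A x) with hg
  have hint : ∀ q : MvPolynomial (Fin N) ℝ, Integrable fun x => eval x q * g x := fun q => by
    have := integrable_eval_mul_weight (p := 0) (by simp) q (e := (A, 0)) hA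
    simpa [weight, hg] using this
  have hq (x : Fin N → ℝ) : HasLineDerivAt ℝ (quad A) (2 * ∑ k, A i k * x k) x (Pi.single i 1) := by
    have h1 (k l : Fin N) : HasDerivAt (fun t : ℝ => A k l * ((x + t • (Pi.single i 1 : Fin N → ℝ)) k *
        (x + t • (Pi.single i 1 : Fin N → ℝ)) l)) (A k l * ((Pi.single i 1 : Fin N → ℝ) k * x l +
          x k * (Pi.single i 1 : Fin N → ℝ) l)) 0 := by
      have h2 (k : Fin N) : HasDerivAt (fun t : ℝ => (x + t • (Pi.single i 1 : Fin N → ℝ)) k)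
          ((Pi.single i 1 : Fin N → ℝ) k) 0 := by
        simpa using ((hasDerivAt_id (0 : ℝ)).mul_const ((Pi.single i 1 : Fin N → ℝ) k)).const_add
          (x k)
      simpa using ((h2 k).mul (h2 l)).const_mul (A k l)
    have h3 := HasDerivAt.fun_sum (u := Finset.univ) fun k _ =>
      HasDerivAt.fun_sum (u := Finset.univ) fun l _ => h1 k l
    refine HasDerivAt.congr_deriv h3 ?_
    simp only [mul_add, Finset.sum_add_distrib, Pi.single_apply, ite_mul, one_mul, zero_mul,
      mul_ite, mul_one, mul_zero, Finset.sum_ite_irrel, Finset.sum_const_zero, Finset.sum_ite_eq',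
      Finset.mem_univ, if_true, two_mul]
    congr 1
    exact Finset.sum_congr rfl fun k _ => by rw [hs k i]
  have hgd (x : Fin N → ℝ) : HasLineDerivAt ℝ g (-(∑ k, A i k * x k) * g x) x
      (Pi.single i 1) := by
    have h1 : HasDerivAt (fun t : ℝ => quad A (x + t • (Pi.single i 1 : Fin N → ℝ))) _ 0 := hq x
    have h2 := (h1.const_mul (-(1 / 2 : ℝ))).exp
    refine HasDerivAt.congr_deriv h2 ?_
    simp [hg]; ring
  have hf (x : Fin N → ℝ) : HasLineDerivAt ℝ (fun x : Fin N → ℝ => x j)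
      ((Pi.single i 1 : Fin N → ℝ) j) x (Pi.single i 1) := by
    simpa [HasLineDerivAt] using ((hasDerivAt_id (0 : ℝ)).mul_const
      ((Pi.single i 1 : Fin N → ℝ) j)).const_add (x j)
  have hi1 : ∀ k, Integrable fun x => A i k * (eval x (.X k * .X j) * g x) :=
    fun k => (hint _).const_mul _
  have hsum : (fun x : Fin N → ℝ => x j * (-(∑ k, A i k * x k) * g x)) =
      fun x => -∑ k, A i k * (eval x (.X k * .X j) * g x) := by
    funext x
    rw [neg_mul, mul_neg, Finset.sum_mul, Finset.mul_sum]
    congr 1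
    refine Finset.sum_congr rfl fun k _ => ?_
    simp; ring
  -- Integration by parts in direction i: ∫ xⱼ ∂ᵢg = -∫ δᵢⱼ g, where ∂ᵢg = -(Ax)ᵢ g by symmetry of
  -- `A`.
  have key := integral_bilinear_hasLineDerivAt_right_eq_neg_left_of_integrable
    (μ := (volume : Measure (Fin N → ℝ))) (B := ContinuousLinearMap.mul ℝ ℝ)
    (f := fun x : Fin N → ℝ => x j) (g := g) (v := Pi.single i 1)
    (f' := fun _ => (Pi.single i 1 : Fin N → ℝ) j) (g' := fun x => -(∑ k, A i k * x k) * g x)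
    (by simpa using (hint 1).const_mul ((Pi.single i 1 : Fin N → ℝ) j))
    (by
      simp only [ContinuousLinearMap.mul_apply', hsum]
      exact (integrable_finsetSum _ fun k _ => hi1 k).neg)
    (by simpa using hint (.X j)) (fun x _ => hf x) (fun x _ => hgd x)
  simp only [ContinuousLinearMap.mul_apply', hsum] at key
  rw [integral_neg, integral_finsetSum _ fun k _ => hi1 k, neg_inj] at key
  simp only [integral_const_mul] at key
  simp only [moment_zero_coupling]
  refine key.trans ?_
  rw [Pi.single_apply]
  by_cases h : i = j
  · simp [h, hg]
  · simp [h, Ne.symm h]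

lemma trace_cfc_log {G : Matrix (Fin N) (Fin N) ℝ} (hG : G.PosDef) :
    (cfc Real.log G).trace = Real.log G.det := by
  rw [hG.isHermitian.cfc_eq, hG.isHermitian.det_eq_prod_eigenvalues, Matrix.IsHermitian.cfc,
    Unitary.conjStarAlgAut_apply, Matrix.trace_mul_cycle]
  simp only [RCLike.ofReal_real_eq_id, id_eq]
  rw [Real.log_prod fun i _ => (hG.eigenvalues_pos i).ne']
  simp [Matrix.trace]

/-! ### The Gibbs variational principle -/

lemma extIntegral_eq_integral {μ : Measure (Fin N → ℝ)} {f : (Fin N → ℝ) → ℝ}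
    (hf : Integrable f μ) : extIntegral μ f = ((∫ x, f x ∂μ : ℝ) : EReal) := by
  rw [integral_eq_lintegral_pos_part_sub_lintegral_neg_part hf, EReal.coe_sub, extIntegral,
    EReal.coe_ennreal_toReal hf.lintegral_lt_top.ne,
    EReal.coe_ennreal_toReal (show ∫⁻ x, ENNReal.ofReal (-f x) ∂μ ≠ ⊤ from
      hf.neg.lintegral_lt_top.ne)]

lemma extIntegral_le_integral {μ : Measure (Fin N → ℝ)} {f g : (Fin N → ℝ) → ℝ}
    (hg : Integrable g μ) (h : f ≤ᵐ[μ] g) :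
    extIntegral μ f ≤ ((∫ x, g x ∂μ : ℝ) : EReal) := by
  rw [← extIntegral_eq_integral hg]
  refine EReal.sub_le_sub (EReal.coe_ennreal_le_coe_ennreal_iff.2 (lintegral_mono_ae ?_))
    (EReal.coe_ennreal_le_coe_ennreal_iff.2 (lintegral_mono_ae ?_))
  · filter_upwards [h] with x hx using ENNReal.ofReal_le_ofReal hx
  · filter_upwards [h] with x hx using ENNReal.ofReal_le_ofReal (neg_le_neg hx)

lemma extIntegral_eq_top_or_integrable {μ : Measure (Fin N → ℝ)} {f : (Fin N → ℝ) → ℝ}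
    (hf : Continuous f) (h : ∀ x, 0 ≤ f x) : extIntegral μ f = ⊤ ∨ Integrable f μ := by
  by_cases hi : ∫⁻ x, ENNReal.ofReal (f x) ∂μ = ⊤
  · left
    have h0 : ∀ x, ENNReal.ofReal (-f x) = 0 := fun x =>
      ENNReal.ofReal_eq_zero.2 (neg_nonpos.2 (h x))
    simp [extIntegral, hi, h0]
  · right
    exact (lintegral_ofReal_ne_top_iff_integrable hf.aestronglyMeasurable (ae_of_all _ h)).1 hi

/-- The trace pairing of two arrays. -/
def pairing (A G : Fin N → Fin N → ℝ) : ℝ := ∑ i, ∑ j, A i j * G i j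

lemma integrable_mul_of_mem_momentFiber {μ : Measure (Fin N → ℝ)} {G : Fin N → Fin N → ℝ}
    (hμ : μ ∈ momentFiber (Matrix.of G)) (i j : Fin N) : Integrable (fun x => x i * x j) μ := by
  refine ((hμ.2.1 i).add (hμ.2.1 j)).mono
    (Continuous.aestronglyMeasurable (by fun_prop)) (ae_of_all _ fun x => ?_)
  rw [Pi.add_apply, Real.norm_of_nonneg (by positivity : 0 ≤ x i ^ 2 + x j ^ 2), Real.norm_eq_abs,
    abs_le]
  constructor <;> nlinarith [sq_nonneg (x i + x j), sq_nonneg (x i - x j)]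

lemma integrable_quad_of_mem_momentFiber {μ : Measure (Fin N → ℝ)} {G : Fin N → Fin N → ℝ}
    (hμ : μ ∈ momentFiber (Matrix.of G)) (A : Fin N → Fin N → ℝ) : Integrable (quad A) μ :=
  integrable_finsetSum _ fun i _ => integrable_finsetSum _ fun j _ =>
    (integrable_mul_of_mem_momentFiber hμ i j).const_mul _

lemma integral_quad_of_mem_momentFiber {μ : Measure (Fin N → ℝ)} {G : Fin N → Fin N → ℝ}
    (hμ : μ ∈ momentFiber (Matrix.of G)) (A : Fin N → Fin N → ℝ) :
    ∫ x, quad A x ∂μ = pairing A G := by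
  have h := integrable_mul_of_mem_momentFiber hμ
  simp only [quad]
  rw [integral_finsetSum _ fun i _ => integrable_finsetSum _ fun j _ => (h i j).const_mul _]
  refine Finset.sum_congr rfl fun i _ => ?_
  rw [integral_finsetSum _ fun j _ => (h i j).const_mul _]
  refine Finset.sum_congr rfl fun j _ => ?_
  rw [integral_const_mul, hμ.2.2 i j, Matrix.of_apply]

lemma integrable_energy {μ : Measure (Fin N → ℝ)} {G : Fin N → Fin N → ℝ}
    (hμ : μ ∈ momentFiber (Matrix.of G)) (A : Fin N → Fin N → ℝ) {V : (Fin N → ℝ) → ℝ}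
    (hV : Integrable V μ) (L : ℝ) : Integrable (fun x => 1 / 2 * quad A x + V x + L) μ :=
  have := hμ.1
  (((integrable_quad_of_mem_momentFiber hμ A).const_mul _).add hV).add (integrable_const L)

lemma integral_energy {μ : Measure (Fin N → ℝ)} {G : Fin N → Fin N → ℝ}
    (hμ : μ ∈ momentFiber (Matrix.of G)) (A : Fin N → Fin N → ℝ) {V : (Fin N → ℝ) → ℝ}
    (hV : Integrable V μ) (L : ℝ) :
    ∫ x, (1 / 2 * quad A x + V x + L) ∂μ = 1 / 2 * pairing A G + ∫ x, V x ∂μ + L := by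
  have := hμ.1
  have i1 : Integrable (fun x => 1 / 2 * quad A x) μ :=
    (integrable_quad_of_mem_momentFiber hμ A).const_mul _
  have i2 : Integrable (fun x => 1 / 2 * quad A x + V x) μ := i1.add hV
  rw [integral_add i2 (integrable_const _), integral_add i1 hV, integral_const_mul,
    integral_quad_of_mem_momentFiber hμ]
  simp

/-- The likelihood ratio of the Gibbs density and the density of `μ` has `μ`-mean at most `1`. -/
lemma lintegral_weight_div_le (hp : ∀ x, 0 ≤ eval x p) {e : (Fin N → Fin N → ℝ) × ℝ}
    (he : e.1 ∈ coercive N) {μ : Measure (Fin N → ℝ)} [IsProbabilityMeasure μ]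
    (hμ : μ ≪ volume) :
    ∫⁻ x, ENNReal.ofReal (weight p e x / (moment p 1 e * (μ.rnDeriv volume x).toReal)) ∂μ ≤ 1 := by
  have hZ := moment_one_pos hp he
  have hw := (continuous_weight p e).measurable
  rw [← lintegral_rnDeriv_mul hμ (Measurable.aemeasurable (by fun_prop))]
  calc _ ≤ ∫⁻ x, ENNReal.ofReal (weight p e x / moment p 1 e) := by
        refine lintegral_mono fun x => ?_
        -- Where the density is 0 or ⊤ the product is 0 (in the second case because `toReal ⊤ = 0`
        -- and division by 0 gives 0). This loss is why only an inequality results.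
        rcases eq_or_ne (μ.rnDeriv volume x) 0 with h0 | h0
        · simp [h0]
        rcases eq_or_ne (μ.rnDeriv volume x) ⊤ with h1 | h1
        · simp [h1]
        have h2 := ENNReal.toReal_pos h0 h1
        rw [← ENNReal.ofReal_toReal h1, ← ENNReal.ofReal_mul h2.le, ENNReal.toReal_ofReal h2.le]
        refine ENNReal.ofReal_le_ofReal (le_of_eq ?_)
        field_simp
    _ = 1 := by
        rw [← ofReal_integral_eq_lintegral_ofReal ((integrable_weight hp he).div_const _)
          (ae_of_all _ fun x => (div_pos (weight_pos p e x) hZ).le), integral_div]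
        have : ∫ x, weight p e x = moment p 1 e := by simp [moment]
        rw [this, div_self hZ.ne', ENNReal.ofReal_one]

/-- Gibbs' inequality. -/
lemma entropy_sub_extIntegral_le (hp : ∀ x, 0 ≤ eval x p) {e : (Fin N → Fin N → ℝ) × ℝ}
    (he : e.1 ∈ coercive N) {G : Fin N → Fin N → ℝ} {μ : Measure (Fin N → ℝ)}
    (hμG : μ ∈ momentFiber (Matrix.of G)) :
    entropy μ - extIntegral μ (fun x => e.2 ^ 2 * eval x p) ≤
      ((1 / 2 * pairing e.1 G + Real.log (moment p 1 e) : ℝ) : EReal) := by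
  have := hμG.1
  have hZ := moment_one_pos hp he
  by_cases hμ : μ ≪ volume
  swap
  · rw [entropy, if_neg hμ, EReal.bot_sub]
    exact bot_le
  -- If the interaction has infinite mean, the left side is -∞.
  rcases extIntegral_eq_top_or_integrable (μ := μ) (f := fun x => e.2 ^ 2 * eval x p)
    ((continuous_eval p).const_mul _) (fun x => mul_nonneg (sq_nonneg _) (hp x)) with hV | hV
  · rw [hV, EReal.sub_top]
    exact bot_le
  set h : (Fin N → ℝ) → ℝ := fun x =>
    weight p e x / (moment p 1 e * (μ.rnDeriv volume x).toReal) with hh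
  have hh0 : ∀ x, 0 ≤ h x := fun x =>
    div_nonneg (weight_pos p e x).le (mul_nonneg hZ.le ENNReal.toReal_nonneg)
  have hle := lintegral_weight_div_le hp he hμ
  have hw := (continuous_weight p e).measurable
  have hhm : Measurable h := by fun_prop
  have hhi : Integrable h μ :=
    (lintegral_ofReal_ne_top_iff_integrable hhm.aestronglyMeasurable (ae_of_all _ hh0)).1
      (ne_top_of_le_ne_top ENNReal.one_ne_top hle)
  have hh1 : ∫ x, h x ∂μ ≤ 1 := by
    rw [← ofReal_integral_eq_lintegral_ofReal hhi (ae_of_all _ hh0)] at hle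
    simpa using hle
  set L := Real.log (moment p 1 e)
  have hE := integrable_energy hμG e.1 hV L
  have hh2 : Integrable (fun x => h x - 1) μ := hhi.sub (integrable_const _)
  have hg : Integrable (fun x => h x - 1 + (1 / 2 * quad e.1 x + e.2 ^ 2 * eval x p + L)) μ :=
    hh2.add hE
  have hbound : (fun x => -Real.log ((μ.rnDeriv volume x).toReal)) ≤ᵐ[μ]
      fun x => h x - 1 + (1 / 2 * quad e.1 x + e.2 ^ 2 * eval x p + L) := by
    filter_upwards [Measure.rnDeriv_pos hμ, hμ.ae_le (Measure.rnDeriv_ne_top μ volume)]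
      with x h0 h1
    have h2 := ENNReal.toReal_pos h0.ne' h1
    -- log h ≤ h - 1 replaces Jensen's inequality: it bounds -log of the density by an integrable
    -- function, and h - 1 has mean at most 0.
    have h3 := Real.log_le_sub_one_of_pos (x := h x)
      (div_pos (weight_pos p e x) (mul_pos hZ h2))
    rw [Real.log_div (weight_pos p e x).ne' (mul_pos hZ h2).ne', Real.log_mul hZ.ne' h2.ne',
      weight, Real.log_exp] at h3
    linarith
  have hint : ∫ x, (h x - 1 + (1 / 2 * quad e.1 x + e.2 ^ 2 * eval x p + L)) ∂μ =
      ∫ x, h x ∂μ - 1 + (1 / 2 * pairing e.1 G + ∫ x, e.2 ^ 2 * eval x p ∂μ + L) := by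
    rw [integral_add hh2 hE, integral_sub hhi (integrable_const _), integral_energy hμG e.1 hV]
    simp
  rw [entropy, if_pos hμ, extIntegral_eq_integral hV]
  refine (EReal.sub_le_sub (extIntegral_le_integral hg hbound) le_rfl).trans ?_
  rw [← EReal.coe_sub, EReal.coe_le_coe_iff, hint]
  linarith

/-- The Gibbs measure with density proportional to the weight. -/
def gibbs (p : MvPolynomial (Fin N) ℝ) (e : (Fin N → Fin N → ℝ) × ℝ) : Measure (Fin N → ℝ) :=
  volume.withDensity fun x => ENNReal.ofReal (weight p e x / moment p 1 e)

lemma measurable_gibbs_density (p : MvPolynomial (Fin N) ℝ) (e : (Fin N → Fin N → ℝ) × ℝ) :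
    Measurable fun x => ENNReal.ofReal (weight p e x / moment p 1 e) := by
  have hw := (continuous_weight p e).measurable
  fun_prop

lemma isProbabilityMeasure_gibbs (hp : ∀ x, 0 ≤ eval x p) {e : (Fin N → Fin N → ℝ) × ℝ}
    (he : e.1 ∈ coercive N) : IsProbabilityMeasure (gibbs p e) := by
  have hZ := moment_one_pos hp he
  refine ⟨?_⟩
  rw [gibbs, withDensity_apply _ MeasurableSet.univ, Measure.restrict_univ,
    ← ofReal_integral_eq_lintegral_ofReal ((integrable_weight hp he).div_const _)
      (ae_of_all _ fun x => (div_pos (weight_pos p e x) hZ).le), integral_div]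
  have : ∫ x, weight p e x = moment p 1 e := by simp [moment]
  rw [this, div_self hZ.ne', ENNReal.ofReal_one]

lemma integrable_gibbs (hp : ∀ x, 0 ≤ eval x p) {e : (Fin N → Fin N → ℝ) × ℝ}
    (he : e.1 ∈ coercive N) (q : MvPolynomial (Fin N) ℝ) :
    Integrable (fun x => eval x q) (gibbs p e) := by
  have hZ := moment_one_pos hp he
  rw [gibbs, integrable_withDensity_iff (measurable_gibbs_density p e)
    (ae_of_all _ fun x => ENNReal.ofReal_lt_top)]
  simp only [ENNReal.toReal_ofReal (div_pos (weight_pos p e _) hZ).le, ← mul_div_assoc]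
  exact (integrable_eval_mul_weight hp q he).div_const _

lemma integral_gibbs (hp : ∀ x, 0 ≤ eval x p) {e : (Fin N → Fin N → ℝ) × ℝ}
    (he : e.1 ∈ coercive N) (q : MvPolynomial (Fin N) ℝ) :
    ∫ x, eval x q ∂(gibbs p e) = moment p q e / moment p 1 e := by
  have hZ := moment_one_pos hp he
  rw [gibbs, integral_withDensity_eq_integral_toReal_smul (measurable_gibbs_density p e)
    (ae_of_all _ fun x => ENNReal.ofReal_lt_top)]
  simp only [ENNReal.toReal_ofReal (div_pos (weight_pos p e _) hZ).le, smul_eq_mul]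
  rw [moment.eq_1 p q, ← integral_div]
  exact integral_congr_ae (ae_of_all _ fun x => by ring)

/-- The second moments of the Gibbs measure. -/
def secondMoment (p : MvPolynomial (Fin N) ℝ) (e : (Fin N → Fin N → ℝ) × ℝ) :
    Fin N → Fin N → ℝ :=
  fun i j => moment p (.X i * .X j) e / moment p 1 e

lemma gibbs_mem_momentFiber (hp : ∀ x, 0 ≤ eval x p) {e : (Fin N → Fin N → ℝ) × ℝ}
    (he : e.1 ∈ coercive N) : gibbs p e ∈ momentFiber (Matrix.of (secondMoment p e)) := by
  refine ⟨isProbabilityMeasure_gibbs hp he, fun i => ?_, fun i j => ?_⟩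
  · have := integrable_gibbs hp he (.X i ^ 2)
    simp only [map_pow, MvPolynomial.eval_X] at this
    exact this
  · have := integral_gibbs hp he (.X i * .X j)
    simp only [map_mul, MvPolynomial.eval_X] at this
    exact this

lemma entropy_gibbs (hp : ∀ x, 0 ≤ eval x p) {e : (Fin N → Fin N → ℝ) × ℝ}
    (he : e.1 ∈ coercive N) :
    entropy (gibbs p e) = ((1 / 2 * pairing e.1 (secondMoment p e) +
      e.2 ^ 2 * (moment p p e / moment p 1 e) + Real.log (moment p 1 e) : ℝ) : EReal) := by
  have hZ := moment_one_pos hp he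
  have hμ : gibbs p e ≪ volume := withDensity_absolutelyContinuous _ _
  have := isProbabilityMeasure_gibbs hp he
  have hG := gibbs_mem_momentFiber hp he
  have hV : Integrable (fun x => e.2 ^ 2 * eval x p) (gibbs p e) :=
    (integrable_gibbs hp he p).const_mul _
  have hae : (fun x => -Real.log (((gibbs p e).rnDeriv volume x).toReal)) =ᵐ[gibbs p e]
      fun x => 1 / 2 * quad e.1 x + e.2 ^ 2 * eval x p + Real.log (moment p 1 e) := by
    filter_upwards [hμ.ae_le (Measure.rnDeriv_withDensity volume (measurable_gibbs_density p e))]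
      with x hx
    rw [gibbs, hx, ENNReal.toReal_ofReal (div_pos (weight_pos p e _) hZ).le,
      Real.log_div (weight_pos p e _).ne' hZ.ne', weight, Real.log_exp]
    ring
  have hi := integrable_energy hG e.1 hV (Real.log (moment p 1 e))
  rw [entropy, if_pos hμ, extIntegral_eq_integral (hi.congr hae.symm), integral_congr_ae hae,
    integral_energy hG e.1 hV, integral_const_mul, integral_gibbs hp he]

/-- Upper bound on the dual functional. -/
lemma dualFunctional_le (hp : ∀ x, 0 ≤ eval x p) {e : (Fin N → Fin N → ℝ) × ℝ}
    (he : e.1 ∈ coercive N) (G : Fin N → Fin N → ℝ) :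
    dualFunctional (Matrix.of G) (fun x => e.2 ^ 2 * eval x p) ≤
      ((1 / 2 * pairing e.1 G + Real.log (moment p 1 e) : ℝ) : EReal) :=
  iSup₂_le fun _ hμ => entropy_sub_extIntegral_le hp he hμ

/-- Lower bound on the dual functional, from a Gibbs measure with another coupling. -/
lemma le_dualFunctional (hp : ∀ x, 0 ≤ eval x p) {e : (Fin N → Fin N → ℝ) × ℝ}
    (he : e.1 ∈ coercive N) (s : ℝ) :
    ((1 / 2 * pairing e.1 (secondMoment p e) + Real.log (moment p 1 e) +
      (e.2 ^ 2 - s ^ 2) * (moment p p e / moment p 1 e) : ℝ) : EReal) ≤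
    dualFunctional (Matrix.of (secondMoment p e)) (fun x => s ^ 2 * eval x p) := by
  refine le_trans (le_of_eq ?_) (le_iSup₂_of_le _ (gibbs_mem_momentFiber hp he) le_rfl)
  rw [entropy_gibbs hp he,
    extIntegral_eq_integral ((integrable_gibbs hp he p).const_mul (s ^ 2)), integral_const_mul,
    integral_gibbs hp he, ← EReal.coe_sub]
  congr 1
  ring

/-- The upper and lower bounds meet when the trial Gibbs measure has the same coupling as the
interaction, so the supremum is attained there. -/
lemma dualFunctional_secondMoment (hp : ∀ x, 0 ≤ eval x p) {e : (Fin N → Fin N → ℝ) × ℝ}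
    (he : e.1 ∈ coercive N) :
    dualFunctional (Matrix.of (secondMoment p e)) (fun x => e.2 ^ 2 * eval x p) =
      ((1 / 2 * pairing e.1 (secondMoment p e) + Real.log (moment p 1 e) : ℝ) : EReal) :=
  (dualFunctional_le hp he _).antisymm <| by
    simpa only [sub_self, zero_mul, add_zero] using le_dualFunctional hp he e.2

/-! ### Inverting the moment map -/

/-- Gaussian integration by parts, divided by the normalization: the covariance is the inverse of
`A`. -/
lemma of_mul_secondMoment_zero_coupling (hp : ∀ x, 0 ≤ eval x p) {A : Fin N → Fin N → ℝ}
    (hs : ∀ i j, A i j = A j i) (hA : A ∈ coercive N) :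
    Matrix.of A * Matrix.of (secondMoment p (A, 0)) = 1 := by
  have hZ := moment_one_pos hp (e := (A, 0)) hA
  ext i j
  simp only [Matrix.mul_apply, Matrix.of_apply, secondMoment, ← mul_div_assoc, ← Finset.sum_div]
  rw [sum_mul_moment_zero_coupling p hs hA, Matrix.one_apply]
  split_ifs <;> simp [hZ.ne']

lemma secondMoment_zero_coupling (hp : ∀ x, 0 ≤ eval x p) {G : Fin N → Fin N → ℝ}
    (hG : (Matrix.of G).PosDef) :
    secondMoment p (Matrix.of.symm (Matrix.of G)⁻¹, 0) = G := by
  set A : Fin N → Fin N → ℝ := Matrix.of.symm (Matrix.of G)⁻¹ with hA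
  have hApos : (Matrix.of A).PosDef := by simpa [hA] using hG.inv
  have h1 := of_mul_secondMoment_zero_coupling hp (A := A)
    (fun i j => by simpa using hApos.isHermitian.apply j i) (coercive_of_posDef hApos)
  have h2 : Matrix.of A * Matrix.of G = 1 := by
    rw [hA, Equiv.apply_symm_apply, Matrix.nonsing_inv_mul _ hG.det_pos.ne'.isUnit]
  have h3 : Matrix.of (secondMoment p (A, 0)) = Matrix.of G := by
    rw [← one_mul (Matrix.of (secondMoment p (A, 0))), ← mul_eq_one_comm.1 h2, mul_assoc, h1,
      mul_one]
  exact Matrix.of.injective h3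

lemma secondMoment_symm (p : MvPolynomial (Fin N) ℝ) (e : (Fin N → Fin N → ℝ) × ℝ)
    (i j : Fin N) : secondMoment p e i j = secondMoment p e j i := by
  simp only [secondMoment, mul_comm]

lemma contDiffAt_secondMoment (hp : ∀ x, 0 ≤ eval x p) {e : (Fin N → Fin N → ℝ) × ℝ}
    (he : e.1 ∈ coercive N) (i j : Fin N) :
    ContDiffAt ℝ (⊤ : ℕ∞) (fun e => secondMoment p e i j) e :=
  (contDiffAt_moment hp _ he).div (contDiffAt_moment hp _ he) (moment_one_pos hp he).ne'

/-- The moment map, together with the antisymmetric part and the coupling, so that it is a local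
diffeomorphism on the space of all arrays. -/
def momentMap (p : MvPolynomial (Fin N) ℝ) (e : (Fin N → Fin N → ℝ) × ℝ) :
    (Fin N → Fin N → ℝ) × ℝ :=
  (fun i j => secondMoment p e i j + (e.1 i j - e.1 j i), e.2)

lemma contDiffAt_momentMap (hp : ∀ x, 0 ≤ eval x p) {e : (Fin N → Fin N → ℝ) × ℝ}
    (he : e.1 ∈ coercive N) : ContDiffAt ℝ (⊤ : ℕ∞) (momentMap p) e := by
  refine ContDiffAt.prodMk (contDiffAt_pi.2 fun i => contDiffAt_pi.2 fun j => ?_) contDiffAt_snd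
  exact (contDiffAt_secondMoment hp he i j).add
    ((entryL i j).contDiff.contDiffAt.sub (entryL j i).contDiff.contDiffAt)

/-- For a kernel vector the coupling component vanishes. The second moments are symmetric and the
added term antisymmetric, so both derivatives vanish separately: `v.1` is symmetric and does not
move the second moments M. Differentiating A(t) M(A(t)) = 1 along the line A + t v then leaves v M =
0, and M is invertible. -/
lemma fderiv_momentMap_injective (hp : ∀ x, 0 ≤ eval x p) {A : Fin N → Fin N → ℝ}
    (hs : ∀ i j, A i j = A j i) (hA : A ∈ coercive N) :
    Function.Injective (fderiv ℝ (momentMap p) (A, 0)) := by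
  have hd := (contDiffAt_momentMap hp (e := (A, 0)) hA).differentiableAt (by simp)
  have hm (i j : Fin N) := ((contDiffAt_secondMoment hp (e := (A, 0)) hA i j).differentiableAt
    (by simp)).hasFDerivAt
  set D := fun i j => fderiv ℝ (fun e => secondMoment p e i j) (A, 0) with hD
  have hDs (i j) : D i j = D j i := by
    simp only [hD, secondMoment_symm p _ i j]
  refine (injective_iff_map_eq_zero _).2 fun v hv => ?_
  have h2 : v.2 = 0 := by
    have h := hd.hasFDerivAt.snd
    have h' : HasFDerivAt (fun e => (momentMap p e).2)
      (ContinuousLinearMap.snd ℝ (Fin N → Fin N → ℝ) ℝ) (A, 0) := hasFDerivAt_snd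
    have := congrArg (fun L => L v) (h.unique h')
    simpa [hv] using this.symm
  have h1 (i j) : D i j v + (v.1 i j - v.1 j i) = 0 := by
    have h := ((entryL i j).hasFDerivAt (x := momentMap p (A, 0))).comp (A, 0) hd.hasFDerivAt
    have h' := (hm i j).add (((entryL i j).hasFDerivAt (x := (A, (0 : ℝ)))).sub
      ((entryL j i).hasFDerivAt (x := (A, (0 : ℝ)))))
    have := congrArg (fun L => L v) (h'.unique h)
    simpa [hv] using this
  have hvs (i j) : v.1 i j = v.1 j i := by
    have h3 := h1 i j
    have h4 := h1 j i
    rw [hDs j i] at h4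
    linarith
  have hDv (i j) : D i j v = 0 := by
    have h3 := h1 i j
    rw [hvs i j] at h3
    linarith
  have hv0 : v = (v.1, 0) := by rw [← h2]
  have hcurve : HasDerivAt (fun t : ℝ => ((A, 0) + t • v : (Fin N → Fin N → ℝ) × ℝ)) v 0 := by
    simpa using ((hasDerivAt_id (0 : ℝ)).smul_const v).const_add ((A, 0) : _ × ℝ)
  have hprod (i j) : HasDerivAt (fun t : ℝ => ∑ k, (A i k + t * v.1 i k) *
      secondMoment p ((A, 0) + t • v) k j)
      (∑ k, v.1 i k * secondMoment p (A, 0) k j) 0 := by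
    refine HasDerivAt.fun_sum fun k _ => ?_
    have h3 : HasDerivAt (fun t : ℝ => A i k + t * v.1 i k) (v.1 i k) 0 := by
      simpa using ((hasDerivAt_id (0 : ℝ)).mul_const (v.1 i k)).const_add (A i k)
    have h4 : HasDerivAt (fun t : ℝ => secondMoment p ((A, 0) + t • v) k j) (D k j v) 0 :=
      HasFDerivAt.comp_hasDerivAt (0 : ℝ) (f := fun t : ℝ => (A, 0) + t • v)
        (l := fun e => secondMoment p e k j) (by simpa using hm k j) hcurve
    exact (h3.fun_mul h4).congr_deriv (by simp [hDv])
  have hconst (i j) : (fun t : ℝ => ∑ k, (A i k + t * v.1 i k) *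
      secondMoment p ((A, 0) + t • v) k j) =ᶠ[𝓝 0] fun _ => (1 : Matrix _ _ ℝ) i j := by
    have hc : ∀ᶠ t : ℝ in 𝓝 0, ((A, 0) + t • v : (Fin N → Fin N → ℝ) × ℝ).1 ∈ coercive N :=
      hcurve.continuousAt.fst.eventually_mem (isOpen_coercive.mem_nhds (by simpa using hA))
    filter_upwards [hc] with t ht
    have h5 : ((A, 0) + t • v : (Fin N → Fin N → ℝ) × ℝ) = (A + t • v.1, 0) := by
      rw [hv0]; simp
    have h6 := of_mul_secondMoment_zero_coupling hp (A := A + t • v.1)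
      (fun i j => by simp [hs i j, hvs i j]) ht
    rw [h5, ← h6]
    simp [Matrix.mul_apply]
  have hmul : Matrix.of v.1 * Matrix.of (secondMoment p (A, 0)) = 0 := by
    ext i j
    have := (hprod i j).unique ((hasDerivAt_const (0 : ℝ) _).congr_of_eventuallyEq (hconst i j))
    simpa [Matrix.mul_apply] using this
  have hinv := mul_eq_one_comm.1 (of_mul_secondMoment_zero_coupling hp hs hA)
  have h7 : Matrix.of v.1 = 0 := by
    rw [← mul_one (Matrix.of v.1), ← hinv, ← mul_assoc, hmul, zero_mul]
  exact Prod.ext (funext fun i => funext fun j => congrFun (congrFun h7 i) j) h2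

/-- Near vanishing coupling, the parameters of a Gibbs measure are a smooth function of its second
moments and of the coupling. -/
lemma exists_inverse_momentMap (hp : ∀ x, 0 ≤ eval x p) {G : Fin N → Fin N → ℝ}
    (hG : (Matrix.of G).PosDef) :
    ∃ B : (Fin N → Fin N → ℝ) × ℝ → Fin N → Fin N → ℝ,
      ContDiffAt ℝ (⊤ : ℕ∞) B (G, 0) ∧ Matrix.of (B (G, 0)) = (Matrix.of G)⁻¹ ∧
      ∀ᶠ y in 𝓝 (G, 0), ContinuousAt B y ∧ ((∀ i j, y.1 i j = y.1 j i) →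
        (∀ i j, B y i j = B y j i) ∧ B y ∈ coercive N ∧ secondMoment p (B y, y.2) = y.1) := by
  set A : Fin N → Fin N → ℝ := Matrix.of.symm (Matrix.of G)⁻¹ with hAdef
  have hApos : (Matrix.of A).PosDef := by simpa [hAdef] using hG.inv
  have hA : A ∈ coercive N := coercive_of_posDef hApos
  have hs : ∀ i j, A i j = A j i := fun i j => by simpa using hApos.isHermitian.apply j i
  have hinj := fderiv_momentMap_injective hp hs hA
  -- In finite dimension an injective endomorphism is invertible, as the inverse function theorem
  -- requires.
  set F' := (LinearEquiv.ofInjectiveEndo (fderiv ℝ (momentMap p) (A, 0)).toLinearMap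
    hinj).toContinuousLinearEquiv with hF'
  have hc := contDiffAt_momentMap hp (e := (A, 0)) hA
  have hd : HasFDerivAt (momentMap p) (F' : _ →L[ℝ] _) (A, 0) :=
    (hc.differentiableAt (by simp)).hasFDerivAt.congr_fderiv (by ext <;> rfl)
  have hAG : secondMoment p (A, 0) = G := secondMoment_zero_coupling hp hG
  have hbase : momentMap p (A, 0) = (G, 0) := by
    refine Prod.ext (funext fun i => funext fun j => ?_) rfl
    simp [momentMap, hAG, hs i j]
  set Ψ := hc.localInverse hd (by simp) with hΨ
  have hΨc : ContDiffAt ℝ (⊤ : ℕ∞) Ψ (G, 0) := hbase ▸ hc.to_localInverse hd (by simp)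
  have hΨ0 : Ψ (G, 0) = (A, 0) := by
    have := hc.localInverse_apply_image hd (by simp)
    rwa [hbase] at this
  have hright : ∀ᶠ y in 𝓝 (G, 0), momentMap p (Ψ y) = y := by
    have := (hc.hasStrictFDerivAt' hd (by simp)).eventually_right_inverse
    rwa [hbase] at this
  have hcont : ∀ᶠ y in 𝓝 (G, 0), ContinuousAt Ψ y := by
    have h1 : ContDiffAt ℝ (1 : ℕ) Ψ (G, 0) := hΨc.of_le (by exact_mod_cast le_top)
    filter_upwards [h1.eventually (by simp)] with y hy using hy.continuousAt
  have hcoer : ∀ᶠ y in 𝓝 (G, 0), (Ψ y).1 ∈ coercive N :=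
    hΨc.continuousAt.fst.eventually_mem (isOpen_coercive.mem_nhds (by simpa [hΨ0] using hA))
  refine ⟨fun y => (Ψ y).1, hΨc.fst, ?_, ?_⟩
  · simp only [hΨ0, hAdef, Equiv.apply_symm_apply]
  · filter_upwards [hright, hcont, hcoer] with y h1 h2 h3
    refine ⟨h2.fst, fun hy => ?_⟩
    have h4 : (momentMap p (Ψ y)).2 = y.2 := congrArg Prod.snd h1
    replace h4 : (Ψ y).2 = y.2 := h4
    have h5 (i j) : secondMoment p (Ψ y) i j + ((Ψ y).1 i j - (Ψ y).1 j i) = y.1 i j :=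
      congrFun (congrFun (congrArg Prod.fst h1) i) j
    -- Comparing the (i, j) and (j, i) equations for symmetric `y` kills the antisymmetric part, and
    -- the moment map reduces to the second moments.
    have h6 (i j) : (Ψ y).1 i j = (Ψ y).1 j i := by
      have := h5 i j
      have h7 := h5 j i
      rw [secondMoment_symm, ← hy i j] at h7
      linarith
    refine ⟨h6, h3, funext fun i => funext fun j => ?_⟩
    rw [← h4]
    simpa [h6 i j] using h5 i j

/-! ### Asymptotic series -/

/-- If the lower coefficients agree, (cₖ - dₖ) εᵏ is O(εᵏ⁺¹), which forces cₖ = dₖ. -/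
lemma IsAsymptoticSeries.coeff_unique {f : ℝ → ℝ} {c d : ℕ → ℝ} (hc : IsAsymptoticSeries f c)
    (hd : IsAsymptoticSeries f d) : ∀ k, 1 ≤ k → c k = d k := by
  intro k
  induction k using Nat.strong_induction_on with
  | _ k ih =>
  intro hk
  have hsum (ε : ℝ) : (f ε - ∑ j ∈ Finset.Icc 1 k, d j * ε ^ j) -
      (f ε - ∑ j ∈ Finset.Icc 1 k, c j * ε ^ j) = (c k - d k) * ε ^ k := by
    obtain ⟨m, rfl⟩ : ∃ m, k = m + 1 := ⟨k - 1, by omega⟩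
    rw [Finset.sum_Icc_succ_top (by omega), Finset.sum_Icc_succ_top (by omega)]
    have : ∑ j ∈ Finset.Icc 1 m, c j * ε ^ j = ∑ j ∈ Finset.Icc 1 m, d j * ε ^ j := by
      refine Finset.sum_congr rfl fun j hj => ?_
      rw [Finset.mem_Icc] at hj
      rw [ih j (by omega) hj.1]
    rw [this]; ring
  have h1 : (fun ε : ℝ => (c k - d k) * ε ^ k) =O[𝓝[>] 0] fun ε : ℝ => ε ^ (k + 1) := by
    simpa only [hsum] using (hd k).sub (hc k)
  have h2 : (fun _ : ℝ => c k - d k) =O[𝓝[>] 0] fun ε : ℝ => ε := by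
    have h3 := h1.mul (isBigO_refl (fun ε : ℝ => (ε ^ k)⁻¹) (𝓝[>] 0))
    refine h3.congr' ?_ ?_
    · filter_upwards [self_mem_nhdsWithin] with ε hε
      have : ε ≠ 0 := ne_of_gt hε
      field_simp
    · filter_upwards [self_mem_nhdsWithin] with ε hε
      have : ε ≠ 0 := ne_of_gt hε
      rw [pow_succ]
      field_simp
  have h4 : Tendsto (fun _ : ℝ => c k - d k) (𝓝[>] 0) (𝓝 0) :=
    h2.trans_tendsto (tendsto_id.mono_left nhdsWithin_le_nhds)
  linarith [tendsto_nhds_unique h4 tendsto_const_nhds]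

lemma IsAsymptoticSeries.sum {ι : Type*} (s : Finset ι) {f : ι → ℝ → ℝ} {c : ι → ℕ → ℝ}
    (a : ι → ℝ) (h : ∀ i ∈ s, IsAsymptoticSeries (f i) (c i)) :
    IsAsymptoticSeries (fun ε => ∑ i ∈ s, a i * f i ε) (fun k => ∑ i ∈ s, a i * c i k) := by
  intro M
  have := IsBigO.sum fun i hi => ((h i hi) M).const_mul_left (a i)
  refine this.congr_left fun ε => ?_
  simp only [Finset.sum_apply, mul_sub, Finset.sum_sub_distrib, Finset.mul_sum, Finset.sum_mul]
  rw [Finset.sum_comm]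
  simp only [mul_assoc]

lemma IsAsymptoticSeries.of_sq {f g : ℝ → ℝ} {c : ℕ → ℝ} (hfg : ∀ᶠ s in 𝓝 0, f (s ^ 2) = g s)
    (h : ∀ M : ℕ, (fun s : ℝ => g s - ∑ k ∈ Finset.Icc 1 M, c k * s ^ (2 * k))
      =O[𝓝 0] fun s : ℝ => s ^ (2 * M + 2)) : IsAsymptoticSeries f c := by
  intro M
  have ht : Tendsto Real.sqrt (𝓝[>] 0) (𝓝 0) := by
    simpa using (Real.continuous_sqrt.tendsto 0).mono_left nhdsWithin_le_nhds
  refine ((h M).comp_tendsto ht).congr' ?_ ?_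
  · filter_upwards [ht.eventually hfg, self_mem_nhdsWithin] with ε h1 hε
    have h2 : √ε ^ 2 = ε := Real.sq_sqrt (le_of_lt hε)
    simp only [Function.comp, ← h1, pow_mul, h2]
  · filter_upwards [self_mem_nhdsWithin] with ε hε
    have h2 : √ε ^ 2 = ε := Real.sq_sqrt (le_of_lt hε)
    simp only [Function.comp, show 2 * M + 2 = 2 * (M + 1) by ring, pow_mul, h2]

lemma taylor_isLittleO_of_contDiffAt {b : ℝ → ℝ} {n : ℕ} (hb : ContDiffAt ℝ n b 0) :
    (fun s => b s - ∑ j ∈ Finset.range (n + 1), iteratedDeriv j b 0 / j.factorial * s ^ j)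
      =o[𝓝 0] fun s : ℝ => s ^ n := by
  obtain ⟨u, hu, hbu⟩ := hb.contDiffOn le_rfl (by simp)
  obtain ⟨r, hr, hru⟩ := Metric.mem_nhds_iff.1 hu
  have h0 : (0 : ℝ) ∈ Metric.ball (0 : ℝ) r := Metric.mem_ball_self hr
  have h := taylor_isLittleO (convex_ball (0 : ℝ) r) h0 (hbu.mono (by simpa using hru))
  rw [Metric.isOpen_ball.nhdsWithin_eq h0] at h
  refine h.congr (fun s => ?_) (fun s => by simp)
  rw [taylor_within_apply]
  congr 1
  refine Finset.sum_congr rfl fun j _ => ?_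
  rw [iteratedDerivWithin_of_isOpen Metric.isOpen_ball h0, sub_zero, smul_eq_mul]
  ring

/-- Averaging over s and -s removes the odd powers. The top even term is kept apart because it has
the order of the error. -/
lemma sum_range_even_part (a : ℕ → ℝ) (s : ℝ) (M : ℕ) :
    (∑ j ∈ Finset.range (2 * M + 3), a j * s ^ j +
      ∑ j ∈ Finset.range (2 * M + 3), a j * (-s) ^ j) / 2 =
    a 0 + ∑ k ∈ Finset.Icc 1 M, a (2 * k) * s ^ (2 * k) + a (2 * M + 2) * s ^ (2 * M + 2) := by
  induction M with
  | zero => simp [Finset.sum_range_succ]; ring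
  | succ M ih =>
    rw [show 2 * (M + 1) + 3 = 2 * M + 3 + 1 + 1 by ring, Finset.sum_range_succ,
      Finset.sum_range_succ, Finset.sum_range_succ _ (2 * M + 3 + 1),
      Finset.sum_range_succ _ (2 * M + 3), Finset.sum_Icc_succ_top (by omega)]
    have h1 : (-s) ^ (2 * M + 3) = -s ^ (2 * M + 3) := Odd.neg_pow ⟨M + 1, by ring⟩ s
    have h2 : (-s) ^ (2 * M + 3 + 1) = s ^ (2 * M + 3 + 1) := Even.neg_pow ⟨M + 2, by ring⟩ s
    rw [h1, h2]
    simp only [show 2 * M + 3 + 1 = 2 * (M + 1) + 2 by ring,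
      show 2 * (M + 1) = 2 * M + 2 by ring] at *
    linarith

/-- A function of `ε` which is a smooth function of `√ε`, extended evenly, has an asymptotic
series. -/
lemma isAsymptoticSeries_of_contDiffAt_sqrt {f b : ℝ → ℝ} (hb : ContDiffAt ℝ (⊤ : ℕ∞) b 0)
    (h0 : b 0 = 0) (hfb : ∀ᶠ s in 𝓝 0, f (s ^ 2) = b s) :
    IsAsymptoticSeries f fun k => iteratedDeriv (2 * k) b 0 / (2 * k).factorial := by
  refine IsAsymptoticSeries.of_sq hfb fun M => ?_
  set a : ℕ → ℝ := fun j => iteratedDeriv j b 0 / j.factorial with ha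
  have hT : (fun s => b s - ∑ j ∈ Finset.range (2 * M + 3), a j * s ^ j)
      =O[𝓝 0] fun s : ℝ => s ^ (2 * M + 2) :=
    (taylor_isLittleO_of_contDiffAt (n := 2 * M + 2)
      (contDiffAt_infty.1 hb _)).isBigO
  have hneg : Tendsto (fun s : ℝ => -s) (𝓝 0) (𝓝 0) := by
    simpa using (continuous_neg.tendsto (0 : ℝ))
  have hT' : (fun s => b (-s) - ∑ j ∈ Finset.range (2 * M + 3), a j * (-s) ^ j)
      =O[𝓝 0] fun s : ℝ => s ^ (2 * M + 2) := by
    refine (hT.comp_tendsto hneg).congr_right fun s => ?_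
    exact Even.neg_pow ⟨M + 1, by ring⟩ s
  have hlast : (fun s : ℝ => a (2 * M + 2) * s ^ (2 * M + 2)) =O[𝓝 0]
      fun s : ℝ => s ^ (2 * M + 2) := (isBigO_refl _ _).const_mul_left _
  refine (((hT.add hT').const_mul_left (1 / 2)).add hlast).congr' ?_ EventuallyEq.rfl
  filter_upwards [hfb, hneg.eventually hfb] with s h1 h2
  have h3 := sum_range_even_part a s M
  -- Near 0, b is even because it depends on s only through s².
  have h4 : b (-s) = b s := by rw [← h1, ← h2, neg_sq]
  have h5 : a 0 = 0 := by simp [ha, h0]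
  change _ = b s - ∑ k ∈ Finset.Icc 1 M, a (2 * k) * s ^ (2 * k)
  rw [h4]
  linarith

/-- Integration of asymptotic series. -/
lemma IsAsymptoticSeries.of_hasDerivAt {f T : ℝ → ℝ} {τ : ℕ → ℝ} (hT : IsAsymptoticSeries T τ)
    (hd : ∀ᶠ ε in 𝓝[>] 0, HasDerivAt f (T ε / (2 * ε)) ε) (h0 : Tendsto f (𝓝[>] 0) (𝓝 0)) :
    IsAsymptoticSeries f fun k => 1 / (2 * (k : ℝ)) * τ k := by
  intro M
  obtain ⟨C, hC⟩ := (hT M).bound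
  obtain ⟨r, hr, h⟩ := (mem_nhdsGT_iff_exists_Ioo_subset (a := (0 : ℝ))).1 (hC.and hd)
  have hr : 0 < r := hr
  set h' : ℝ → ℝ := fun ε => f ε - ∑ k ∈ Finset.Icc 1 M, 1 / (2 * (k : ℝ)) * τ k * ε ^ k
  have hder : ∀ ε ∈ Set.Ioo 0 r, HasDerivAt h'
      ((T ε - ∑ k ∈ Finset.Icc 1 M, τ k * ε ^ k) / (2 * ε)) ε := by
    intro ε hε
    have hsum := HasDerivAt.fun_sum (u := Finset.Icc 1 M) fun k _ =>
      (hasDerivAt_pow k ε).const_mul (1 / (2 * (k : ℝ)) * τ k)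
    refine ((h hε).2.sub hsum).congr_deriv ?_
    rw [sub_div, Finset.sum_div]
    congr 1
    refine Finset.sum_congr rfl fun k hk => ?_
    obtain ⟨m, rfl⟩ : ∃ m, k = m + 1 := ⟨k - 1, by have := (Finset.mem_Icc.1 hk).1; omega⟩
    have := hε.1.ne'
    rw [Nat.add_sub_cancel, pow_succ]
    field_simp
  -- Dividing the O(ε^(M+1)) remainder of `T` by 2ε costs one power, which integration restores.
  have hbd : ∀ ε ∈ Set.Ioo 0 r,
      ‖(T ε - ∑ k ∈ Finset.Icc 1 M, τ k * ε ^ k) / (2 * ε)‖ ≤ |C| * ε ^ M := by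
    intro ε hε
    have h1 : ‖T ε - ∑ k ∈ Finset.Icc 1 M, τ k * ε ^ k‖ ≤ C * ‖ε ^ (M + 1)‖ := (h hε).1
    have hε0 := hε.1
    rw [Real.norm_of_nonneg (pow_nonneg hε0.le (M + 1))] at h1
    rw [norm_div, Real.norm_of_nonneg (by positivity : 0 ≤ 2 * ε), div_le_iff₀ (by positivity)]
    have h2 : C * ε ^ (M + 1) ≤ |C| * ε ^ (M + 1) := by gcongr; exact le_abs_self C
    have h3 : 0 ≤ |C| * ε ^ (M + 1) := by positivity
    calc _ ≤ |C| * ε ^ (M + 1) := h1.trans h2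
      _ ≤ _ := by rw [pow_succ] at h3 ⊢; linarith
  have hlim : Tendsto h' (𝓝[>] 0) (𝓝 0) := by
    have h1 : Tendsto (fun ε : ℝ => ∑ k ∈ Finset.Icc 1 M, 1 / (2 * (k : ℝ)) * τ k * ε ^ k)
        (𝓝[>] 0) (𝓝 (∑ k ∈ Finset.Icc 1 M, 1 / (2 * (k : ℝ)) * τ k * 0 ^ k)) :=
      (Continuous.tendsto (by fun_prop) 0).mono_left nhdsWithin_le_nhds
    have h2 : ∑ k ∈ Finset.Icc 1 M, 1 / (2 * (k : ℝ)) * τ k * (0 : ℝ) ^ k = 0 :=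
      Finset.sum_eq_zero fun k hk => by
        rw [zero_pow (by have := (Finset.mem_Icc.1 hk).1; omega), mul_zero]
    rw [h2] at h1
    have h3 := h0.sub h1
    rwa [sub_zero] at h3
  refine IsBigO.of_bound |C| ?_
  filter_upwards [Ioo_mem_nhdsGT hr] with ε hε
  rw [Real.norm_of_nonneg (pow_nonneg hε.1.le _)]
  -- The mean value inequality is applied on [a, ε] and a tends to 0 afterwards, since nothing is
  -- assumed about `f` at 0 itself.
  have hmv : ∀ a ∈ Set.Ioo 0 ε, ‖h' ε - h' a‖ ≤ |C| * ε ^ (M + 1) := by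
    intro a ha
    have h1 := Convex.norm_image_sub_le_of_norm_hasDerivWithin_le (𝕜 := ℝ) (f := h')
      (s := Set.Icc a ε) (C := |C| * ε ^ M)
      (fun x hx => (hder x ⟨ha.1.trans_le hx.1, hx.2.trans_lt hε.2⟩).hasDerivWithinAt)
      (fun x hx => (hbd x ⟨ha.1.trans_le hx.1, hx.2.trans_lt hε.2⟩).trans (by
        gcongr
        · exact ha.1.le.trans hx.1
        · exact hx.2))
      (convex_Icc a ε) (Set.left_mem_Icc.2 ha.2.le) (Set.right_mem_Icc.2 ha.2.le)
    refine h1.trans ?_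
    rw [Real.norm_of_nonneg (by linarith [ha.2]), pow_succ, mul_assoc]
    have := hε.1
    gcongr
    linarith [ha.1]
  have hlim' : Tendsto (fun a => ‖h' ε - h' a‖) (𝓝[>] 0) (𝓝 ‖h' ε - 0‖) :=
    (tendsto_const_nhds.sub hlim).norm
  rw [sub_zero] at hlim'
  exact le_of_tendsto hlim' (by filter_upwards [Ioo_mem_nhdsGT hε.1] with a ha using hmv a ha)

/-! ### Differentiability from tangent functionals -/

/-- A function with a continuous family of supporting functionals from above is differentiable. -/
lemma hasFDerivWithinAt_of_tangent {E : Type*} [NormedAddCommGroup E] [NormedSpace ℝ E]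
    {f : E → ℝ} {a : E → E →L[ℝ] ℝ} {s : Set E} {x : E}
    (h : ∀ᶠ y in 𝓝[s] x, f y ≤ f x + a x (y - x) ∧ f x ≤ f y + a y (x - y))
    (ha : ContinuousWithinAt a s x) : HasFDerivWithinAt f (a x) s x := by
  rw [hasFDerivWithinAt_iff_isLittleO, isLittleO_iff]
  intro c hc
  have hac : ∀ᶠ y in 𝓝[s] x, ‖a y - a x‖ < c := by
    have := ha.eventually (Metric.ball_mem_nhds (a x) hc)
    simpa [dist_eq_norm] using this
  filter_upwards [h, hac] with y hy hn
  -- The two tangent inequalities place f y - f x - a x (y - x) between (a y - a x)(y - x) and 0.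
  have h1 : a y (x - y) = -a y (y - x) := by rw [← map_neg, neg_sub]
  have h2 := (a y - a x).le_opNorm (y - x)
  have h3 : ‖a y - a x‖ * ‖y - x‖ ≤ c * ‖y - x‖ := by gcongr
  rw [sub_apply, Real.norm_eq_abs, abs_le] at h2
  rw [Real.norm_eq_abs, abs_le]
  have h4 := mul_nonneg hc.le (norm_nonneg (y - x))
  constructor <;> linarith [hy.1, hy.2, h2.1, h2.2]

/-! ### The dual functional near vanishing coupling -/

/-- The real value of the dual functional with interaction `s² p`. -/
def dualReal (p : MvPolynomial (Fin N) ℝ) (s : ℝ) (G : Fin N → Fin N → ℝ) : ℝ :=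
  (dualFunctional (Matrix.of G) (fun x => s ^ 2 * eval x p)).toReal

lemma symm_of_posDef {G : Fin N → Fin N → ℝ} (hG : (Matrix.of G).PosDef) (i j : Fin N) :
    G i j = G j i := by
  simpa using hG.isHermitian.apply j i

lemma coercive_inv {G : Fin N → Fin N → ℝ} (hG : (Matrix.of G).PosDef) :
    Matrix.of.symm (Matrix.of G)⁻¹ ∈ coercive N :=
  coercive_of_posDef (by simpa using hG.inv)

/-- Finite from above by Gibbs' inequality with quadratic part G⁻¹, and from below because the
Gaussian of covariance G is a trial measure with finite quartic mean. -/
lemma dualFunctional_ne_top_bot (hp : ∀ x, 0 ≤ eval x p) {G : Fin N → Fin N → ℝ}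
    (hG : (Matrix.of G).PosDef) (s : ℝ) :
    dualFunctional (Matrix.of G) (fun x => s ^ 2 * eval x p) ≠ ⊤ ∧
      dualFunctional (Matrix.of G) (fun x => s ^ 2 * eval x p) ≠ ⊥ := by
  constructor
  · exact ne_top_of_le_ne_top (EReal.coe_ne_top _)
      (dualFunctional_le hp (e := (_, s)) (coercive_inv hG) G)
  · have h := le_dualFunctional hp (e := (_, 0)) (coercive_inv hG) s
    rw [secondMoment_zero_coupling hp hG] at h
    exact ne_bot_of_le_ne_bot (EReal.coe_ne_bot _) h

lemma dualReal_le (hp : ∀ x, 0 ≤ eval x p) {G : Fin N → Fin N → ℝ}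
    (hG : (Matrix.of G).PosDef) {A : Fin N → Fin N → ℝ} (hA : A ∈ coercive N) (s : ℝ) :
    dualReal p s G ≤ 1 / 2 * pairing A G + Real.log (moment p 1 (A, s)) := by
  have h := dualFunctional_le hp (e := (A, s)) hA G
  rw [← EReal.coe_toReal (dualFunctional_ne_top_bot hp hG s).1
    (dualFunctional_ne_top_bot hp hG s).2] at h
  exact EReal.coe_le_coe_iff.1 h

lemma dualReal_eq (hp : ∀ x, 0 ≤ eval x p) {G A : Fin N → Fin N → ℝ} {s : ℝ}
    (hA : A ∈ coercive N) (h : secondMoment p (A, s) = G) :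
    dualReal p s G = 1 / 2 * pairing A G + Real.log (moment p 1 (A, s)) := by
  rw [dualReal, ← h, dualFunctional_secondMoment hp (e := (A, s)) hA, EReal.toReal_coe]

lemma pairing_eq_trace (A G : Fin N → Fin N → ℝ) :
    pairing A G = (Matrix.of A * (Matrix.of G)ᵀ).trace := by
  simp [pairing, Matrix.trace, Matrix.mul_apply]

/-- Tr log G + N log(2πe) is twice the Gaussian value of ℱ at zero coupling, so the normalization of
Φ is a subtraction of the free theory. -/
lemma lwFunctional_eq (hp : ∀ x, 0 ≤ eval x p) {G : Fin N → Fin N → ℝ}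
    (hG : (Matrix.of G).PosDef) (s : ℝ) :
    lwFunctional (Matrix.of G) (fun x => s ^ 2 * eval x p) =
      2 * (dualReal p s G - dualReal p 0 G) := by
  have hdet := hG.det_pos
  have hpair : pairing (Matrix.of.symm (Matrix.of G)⁻¹) G = N := by
    rw [pairing_eq_trace, Equiv.apply_symm_apply]
    have : (Matrix.of G)ᵀ = Matrix.of G := by
      ext i j; exact symm_of_posDef hG j i
    rw [this, Matrix.nonsing_inv_mul _ hdet.ne'.isUnit, Matrix.trace_one, Fintype.card_fin]
  have hlog : Real.log (√(2 * Real.pi) ^ N * √(Matrix.of G).det) =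
      N * (Real.log (2 * Real.pi) / 2) + Real.log (Matrix.of G).det / 2 := by
    rw [Real.log_mul (by positivity) (by positivity), Real.log_pow, Real.log_sqrt hdet.le,
      Real.log_sqrt (by positivity)]
  rw [lwFunctional, trace_cfc_log hG,
    dualReal_eq hp (coercive_inv hG) (secondMoment_zero_coupling hp hG), hpair,
    moment_one_zero_coupling p (by simpa using hG.inv), Equiv.apply_symm_apply,
    Matrix.det_nonsing_inv, Ring.inverse_eq_inv', Real.sqrt_inv, inv_inv,
    hlog, Real.log_mul (by positivity) (Real.exp_ne_zero _), Real.log_exp, dualReal]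
  ring

/-- The pairing with a fixed array, as a continuous linear functional. -/
def pairingL (A : Fin N → Fin N → ℝ) : (Fin N → Fin N → ℝ) →L[ℝ] ℝ :=
  ∑ i, ∑ j, A i j • (ContinuousLinearMap.proj j).comp
    (ContinuousLinearMap.proj (R := ℝ) (φ := fun _ : Fin N => Fin N → ℝ) i)

@[simp] lemma pairingL_apply (A G : Fin N → Fin N → ℝ) : pairingL A G = pairing A G := by
  simp [pairingL, pairing]

lemma continuous_pairingL : Continuous (pairingL (N := N)) := by
  unfold pairingL; fun_prop

lemma pairing_sub (A G H : Fin N → Fin N → ℝ) : pairing A (G - H) = pairing A G - pairing A H := by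
  simp only [← pairingL_apply, map_sub]

lemma sub_pairing (A B G : Fin N → Fin N → ℝ) : pairing (A - B) G = pairing A G - pairing B G := by
  simp [pairing, sub_mul]

/-- The symmetric arrays. -/
def symmArrays (N : ℕ) : Set (Fin N → Fin N → ℝ) := {G | (Matrix.of G).IsSymm}

/-- Positive definiteness includes symmetry, so it is open only relative to the symmetric arrays. -/
lemma eventually_posDef {G : Fin N → Fin N → ℝ} (hG : (Matrix.of G).PosDef) :
    ∀ᶠ G' in 𝓝[symmArrays N] G, (Matrix.of G').PosDef := by
  filter_upwards [self_mem_nhdsWithin,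
    mem_nhdsWithin_of_mem_nhds (isOpen_coercive.mem_nhds (coercive_of_posDef hG))] with G' h1 h2
  exact posDef_of_coercive (fun i j => (h1.apply i j).symm) h2

/-- The dual functional is differentiable where the moment map has a continuous section. -/
lemma hasFDerivWithinAt_dualReal (hp : ∀ x, 0 ≤ eval x p) {G : Fin N → Fin N → ℝ}
    (hG : (Matrix.of G).PosDef) {s : ℝ} {B : (Fin N → Fin N → ℝ) → Fin N → Fin N → ℝ}
    (hB : ContinuousAt B G)
    (h : ∀ᶠ G' in 𝓝[symmArrays N] G, B G' ∈ coercive N ∧ secondMoment p (B G', s) = G') :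
    HasFDerivWithinAt (dualReal p s) ((1 / 2 : ℝ) • pairingL (B G)) (symmArrays N) G := by
  have hGs : G ∈ symmArrays N := by
    ext i j; exact symm_of_posDef hG j i
  obtain ⟨h1, h2⟩ := h.self_of_nhdsWithin hGs
  refine hasFDerivWithinAt_of_tangent (a := fun G' => (1 / 2 : ℝ) • pairingL (B G')) ?_ ?_
  -- The variational bound with parameter `B G` is affine in the moments and exact at `G`; likewise
  -- for `B G'` at `G'`. These are the two tangent inequalities.
  · filter_upwards [h, eventually_posDef hG] with G' ⟨h3, h4⟩ h5
    have e1 := dualReal_eq hp h1 h2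
    have e2 := dualReal_eq hp h3 h4
    have e3 := dualReal_le hp h5 h1 s
    have e4 := dualReal_le hp hG h3 s
    simp only [smul_apply, pairingL_apply, pairing_sub, smul_eq_mul]
    constructor <;> linarith
  · have hc : ContinuousAt (fun G' => pairingL (B G')) G := continuous_pairingL.continuousAt.comp hB
    exact (hc.const_smul (1 / 2 : ℝ)).continuousWithinAt

/-- The Dyson equation: the gradient of Φ is the interacting quadratic part minus the free one, from
twice the difference of the gradients ½B(G, s) and ½B(G, 0). -/
lemma hasFDerivWithinAt_lwFunctional (hp : ∀ x, 0 ≤ eval x p) {G : Fin N → Fin N → ℝ}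
    (hG : (Matrix.of G).PosDef) {B : (Fin N → Fin N → ℝ) × ℝ → Fin N → Fin N → ℝ}
    (hB : ∀ᶠ y in 𝓝 (G, 0), ContinuousAt B y ∧ ((∀ i j, y.1 i j = y.1 j i) →
      (∀ i j, B y i j = B y j i) ∧ B y ∈ coercive N ∧ secondMoment p (B y, y.2) = y.1)) :
    ∀ᶠ s in 𝓝 (0 : ℝ), HasFDerivWithinAt
      (fun G' => lwFunctional (Matrix.of G') (fun x => s ^ 2 * eval x p))
      (pairingL (B (G, s) - B (G, 0))) (symmArrays N) G := by
  have hdual : ∀ᶠ s in 𝓝 (0 : ℝ), HasFDerivWithinAt (dualReal p s)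
      ((1 / 2 : ℝ) • pairingL (B (G, s))) (symmArrays N) G := by
    have hcs : ContinuousAt (fun s : ℝ => (G, s)) 0 := by fun_prop
    filter_upwards [hcs.eventually hB.eventually_nhds] with s hs
    have hcG : ContinuousAt (fun G' : Fin N → Fin N → ℝ => (G', s)) G := by fun_prop
    refine hasFDerivWithinAt_dualReal hp hG (B := fun G' => B (G', s))
      (ContinuousAt.comp (f := fun G' : Fin N → Fin N → ℝ => (G', s)) hs.self_of_nhds.1 hcG) ?_
    filter_upwards [self_mem_nhdsWithin, mem_nhdsWithin_of_mem_nhds (hcG.eventually hs)]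
      with G' h1 h2
    exact (h2.2 fun i j => (h1.apply i j).symm).2
  have h0 := hdual.self_of_nhds
  filter_upwards [hdual] with s hs
  have hsum := (hs.sub h0).const_mul 2
  refine (hsum.congr_of_eventuallyEq ?_ ?_).congr_fderiv ?_
  · filter_upwards [eventually_posDef hG] with G' hG' using lwFunctional_eq hp hG' s
  · exact lwFunctional_eq hp hG s
  · ext H
    simp only [smul_apply, sub_apply, pairingL_apply, sub_pairing, smul_eq_mul]
    ring

/-! ### Scaling -/

lemma eval_smul_of_isHomogeneous {q : MvPolynomial (Fin N) ℝ} {n : ℕ} (hq : q.IsHomogeneous n)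
    (r : ℝ) (x : Fin N → ℝ) : eval (r • x) q = r ^ n * eval x q := by
  rw [MvPolynomial.eval_eq', MvPolynomial.eval_eq', Finset.mul_sum]
  refine Finset.sum_congr rfl fun m hm => ?_
  have h : ∑ i, m i = n := by
    rw [hq.degree_eq_sum_deg_support hm, ← Finsupp.degree_eq_sum]
    rfl
  simp only [Pi.smul_apply, smul_eq_mul, mul_pow, Finset.prod_mul_distrib,
    Finset.prod_pow_eq_pow_sum, h]
  ring

/-- Along the ray t x the quartic term outgrows the quadratic allowance; divide by t⁴ and let t → ∞.
-/
lemma eval_nonneg_of_isHomogeneous (hq : p.IsHomogeneous 4) {C : ℝ}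
    (h : ∀ x : Fin N → ℝ, 0 ≤ eval x p + C * (1 + x ⬝ᵥ x)) (x : Fin N → ℝ) : 0 ≤ eval x p := by
  have h1 (t : ℝ) : 0 ≤ t ^ 4 * eval x p + C * (1 + t ^ 2 * (x ⬝ᵥ x)) := by
    have := h (t • x)
    rw [eval_smul_of_isHomogeneous hq, smul_dotProduct, dotProduct_smul, smul_eq_mul,
      smul_eq_mul] at this
    linarith
  have h2 : Tendsto (fun t : ℝ => eval x p + C * (t⁻¹ ^ 4 + t⁻¹ ^ 2 * (x ⬝ᵥ x))) atTop
      (𝓝 (eval x p + C * (0 ^ 4 + 0 ^ 2 * (x ⬝ᵥ x)))) :=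
    ((((tendsto_inv_atTop_zero.pow 4).add
      ((tendsto_inv_atTop_zero.pow 2).mul_const _)).const_mul C).const_add _)
  have h3 : eval x p + C * (0 ^ 4 + 0 ^ 2 * (x ⬝ᵥ x)) = eval x p := by ring
  rw [h3] at h2
  refine ge_of_tendsto h2 ?_
  filter_upwards [eventually_gt_atTop 0] with t ht
  have h4 : eval x p + C * (t⁻¹ ^ 4 + t⁻¹ ^ 2 * (x ⬝ᵥ x)) =
      (t ^ 4 * eval x p + C * (1 + t ^ 2 * (x ⬝ᵥ x))) / t ^ 4 := by
    field_simp
  rw [h4]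
  exact div_nonneg (h1 t) (by positivity)

/-- Substitute x ↦ r x: the Jacobian gives r^N, the degree of `q` gives r^n, and s² p(rx) = (r² s)²
p(x) because `p` is quartic. -/
lemma moment_scaling (hp4 : p.IsHomogeneous 4) {q : MvPolynomial (Fin N) ℝ} {n : ℕ}
    (hq : q.IsHomogeneous n) {r : ℝ} (hr : 0 < r) (A : Fin N → Fin N → ℝ) (s : ℝ) :
    moment p q ((r ^ 2)⁻¹ • A, s) = r ^ N * (r ^ n * moment p q (A, r ^ 2 * s)) := by
  have h := Measure.integral_comp_smul (volume : Measure (Fin N → ℝ))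
    (fun x => eval x q * weight p ((r ^ 2)⁻¹ • A, s) x) r
  have h2 (x : Fin N → ℝ) : eval (r • x) q * weight p ((r ^ 2)⁻¹ • A, s) (r • x) =
      r ^ n * (eval x q * weight p (A, r ^ 2 * s) x) := by
    have h3 : quad ((r ^ 2)⁻¹ • A) x = (r ^ 2)⁻¹ * quad A x := by
      simp [quad, Finset.mul_sum, mul_assoc]
    simp only [weight, eval_smul_of_isHomogeneous hq, eval_smul_of_isHomogeneous hp4, quad_smul,
      h3]
    rw [mul_inv_cancel_left₀ (by positivity)]
    ring_nf
  simp only [h2] at h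
  rw [integral_const_mul, Module.finrank_fin_fun, abs_of_pos (by positivity), smul_eq_mul] at h
  rw [moment, moment, h, mul_inv_cancel_left₀ (by positivity)]

/-- Dilation maps Gibbs measures to Gibbs measures. The trace pairing is invariant, so only log Z
changes, by N log r. -/
lemma dualReal_scaling (hp : ∀ x, 0 ≤ eval x p) (hp4 : p.IsHomogeneous 4) {r : ℝ} (hr : 0 < r)
    {G A : Fin N → Fin N → ℝ} {s : ℝ} (hA : A ∈ coercive N)
    (h : secondMoment p (A, r ^ 2 * s) = G) :
    dualReal p s (r ^ 2 • G) = dualReal p (r ^ 2 * s) G + N * Real.log r := by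
  have hA' : (r ^ 2)⁻¹ • A ∈ coercive N := by
    obtain ⟨c, hc, h⟩ := hA
    refine ⟨(r ^ 2)⁻¹ * c, by positivity, fun x => ?_⟩
    have h3 : quad ((r ^ 2)⁻¹ • A) x = (r ^ 2)⁻¹ * quad A x := by
      simp [quad, Finset.mul_sum, mul_assoc]
    rw [h3, mul_assoc]
    gcongr
    exact h x
  have hZ := moment_one_pos hp (e := (A, r ^ 2 * s)) hA
  have h1 := moment_scaling hp4 (MvPolynomial.isHomogeneous_one (Fin N) ℝ) hr A s
  rw [pow_zero, one_mul] at h1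
  have h2 : secondMoment p ((r ^ 2)⁻¹ • A, s) = r ^ 2 • G := by
    rw [← h]
    funext i j
    have h3 := moment_scaling hp4 ((MvPolynomial.isHomogeneous_X ℝ i).mul
      (MvPolynomial.isHomogeneous_X ℝ j)) hr A s
    simp only [secondMoment, Pi.smul_apply, smul_eq_mul, h1, h3]
    field_simp
  rw [dualReal_eq hp hA' h2, dualReal_eq hp hA h, h1, Real.log_mul (by positivity) hZ.ne',
    Real.log_pow]
  have h4 : pairing ((r ^ 2)⁻¹ • A) (r ^ 2 • G) = pairing A G := by
    refine Finset.sum_congr rfl fun i _ => Finset.sum_congr rfl fun j _ => ?_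
    simp only [Pi.smul_apply, smul_eq_mul]
    field_simp
  rw [h4]
  ring

lemma lwFunctional_scaling (hp : ∀ x, 0 ≤ eval x p) (hp4 : p.IsHomogeneous 4) {r : ℝ}
    (hr : 0 < r) {G A : Fin N → Fin N → ℝ} (hG : (Matrix.of G).PosDef) {s : ℝ}
    (hA : A ∈ coercive N) (h : secondMoment p (A, r ^ 2 * s) = G) :
    lwFunctional (Matrix.of (r ^ 2 • G)) (fun x => s ^ 2 * eval x p) =
      lwFunctional (Matrix.of G) (fun x => (r ^ 2 * s) ^ 2 * eval x p) := by
  have hG' : (Matrix.of (r ^ 2 • G)).PosDef := hG.smul (by positivity : 0 < r ^ 2)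
  -- At zero coupling the shift is the same N log r, so it cancels in Φ.
  have h0 : secondMoment p (Matrix.of.symm (Matrix.of G)⁻¹, r ^ 2 * 0) = G := by
    rw [mul_zero, secondMoment_zero_coupling hp hG]
  rw [lwFunctional_eq hp hG', lwFunctional_eq hp hG, dualReal_scaling hp hp4 hr hA h,
    dualReal_scaling hp hp4 hr (coercive_inv hG) h0, mul_zero]
  ring

/-! ### The self-energy and the asymptotic series -/

/-- Pairing with E^{(ij)} gives D i j + D j i, on the diagonal too, which the factor 1/2 reduces to
D i j. The line G + δ E^{(ij)} stays symmetric, so a derivative within the symmetric arrays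
suffices. -/
lemma selfEnergy_eq {G D : Fin N → Fin N → ℝ} {V : (Fin N → ℝ) → ℝ}
    (hG : G ∈ symmArrays N) (hD : ∀ i j, D i j = D j i)
    (h : HasFDerivWithinAt (fun G' => lwFunctional (Matrix.of G') V) (pairingL D)
      (symmArrays N) G) (i j : Fin N) :
    selfEnergy (Matrix.of G) V i j = D i j := by
  set E : Fin N → Fin N → ℝ := Matrix.of.symm (symUnit i j) with hE
  have hc : HasDerivAt (fun δ : ℝ => G + δ • E) E 0 := by
    simpa using ((hasDerivAt_id (0 : ℝ)).smul_const E).const_add G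
  have hsymm : ∀ δ : ℝ, G + δ • E ∈ symmArrays N := fun δ => by
    have h1 : (symUnit i j).IsSymm := by
      simp [Matrix.IsSymm, symUnit, add_comm]
    exact Matrix.IsSymm.add hG (h1.smul δ)
  have hd := h.comp_hasDerivAt_of_eq (0 : ℝ) hc (Eventually.of_forall hsymm) (by simp)
  have hp : pairing D E = D i j + D j i := by
    simp [pairing, hE, symUnit, mul_add, Finset.sum_add_distrib, Matrix.single_apply, ite_and]
  have h2 : deriv (fun δ : ℝ => lwFunctional (Matrix.of G + δ • symUnit i j) V) 0 =
      D i j + D j i := by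
    rw [← hp, ← pairingL_apply]
    exact hd.deriv
  rw [selfEnergy, Matrix.of_apply, h2, hD j i]
  ring

/-- A section of the moment map with the properties that the expansion uses. -/
structure IsSmoothSection (p : MvPolynomial (Fin N) ℝ) (G : Fin N → Fin N → ℝ)
    (b : ℝ → Fin N → Fin N → ℝ) : Prop where
  contDiffAt : ContDiffAt ℝ (⊤ : ℕ∞) b 0
  symm : ∀ᶠ s in 𝓝 0, ∀ i j, b s i j = b s j i
  coercive : ∀ᶠ s in 𝓝 0, b s ∈ coercive N
  secondMoment : ∀ᶠ s in 𝓝 0, secondMoment p (b s, s) = G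
  hasFDerivWithinAt : ∀ᶠ s in 𝓝 (0 : ℝ), HasFDerivWithinAt
    (fun G' => lwFunctional (Matrix.of G') (fun x => s ^ 2 * eval x p))
    (pairingL (b s - b 0)) (symmArrays N) G

lemma exists_isSmoothSection (hp : ∀ x, 0 ≤ eval x p) {G : Fin N → Fin N → ℝ}
    (hG : (Matrix.of G).PosDef) : ∃ b, IsSmoothSection p G b := by
  obtain ⟨B, hB, -, h⟩ := exists_inverse_momentMap hp hG
  have hs : ∀ᶠ s in 𝓝 (0 : ℝ), _ :=
    (show ContinuousAt (fun s : ℝ => (G, s)) 0 by fun_prop).eventually h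
  have hGs := symm_of_posDef hG
  refine ⟨fun s => B (G, s), ?_, ?_, ?_, ?_, hasFDerivWithinAt_lwFunctional hp hG h⟩
  · exact ContDiffAt.comp (0 : ℝ) (f := fun s : ℝ => (G, s)) hB
      (contDiffAt_const.prodMk contDiffAt_id)
  · filter_upwards [hs] with s h1 using (h1.2 hGs).1
  · filter_upwards [hs] with s h1 using (h1.2 hGs).2.1
  · filter_upwards [hs] with s h1 using (h1.2 hGs).2.2

namespace IsSmoothSection

variable {G : Fin N → Fin N → ℝ} {b : ℝ → Fin N → Fin N → ℝ}

lemma selfEnergy_eq (hb : IsSmoothSection p G b) (hG : (Matrix.of G).PosDef) :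
    ∀ᶠ s in 𝓝 (0 : ℝ), ∀ i j,
      selfEnergy (Matrix.of G) (fun x => s ^ 2 * eval x p) i j = b s i j - b 0 i j := by
  have h0 := hb.symm.self_of_nhds
  filter_upwards [hb.symm, hb.hasFDerivWithinAt] with s h1 h2 i j
  refine LuttingerWard.selfEnergy_eq (D := b s - b 0) ?_ (fun i j => ?_) h2 i j
  · ext i j; exact symm_of_posDef hG j i
  · simp [h0 i j, h1 i j]

lemma isAsymptoticSeries_selfEnergy (hb : IsSmoothSection p G b) (hG : (Matrix.of G).PosDef)
    (i j : Fin N) : ∃ c, IsAsymptoticSeries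
      (fun ε => selfEnergy (Matrix.of G) (fun x => ε * eval x p) i j) c := by
  refine ⟨_, isAsymptoticSeries_of_contDiffAt_sqrt (b := fun s => b s i j - b 0 i j) ?_ (by simp) ?_⟩
  · exact (contDiffAt_pi.1 (contDiffAt_pi.1 hb.contDiffAt i) j).sub contDiffAt_const
  · filter_upwards [hb.selfEnergy_eq hG] with s hs using hs i j

/-- This limit fixes the constant of integration when Φ is recovered from its derivative in ε. -/
lemma tendsto_lwFunctional (hb : IsSmoothSection p G b) (hp : ∀ x, 0 ≤ eval x p)
    (hG : (Matrix.of G).PosDef) :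
    Tendsto (fun ε : ℝ => lwFunctional (Matrix.of G) (fun x => ε * eval x p)) (𝓝[>] 0) (𝓝 0) := by
  set g : ℝ → ℝ := fun s =>
    2 * (1 / 2 * pairing (b s) G + Real.log (moment p 1 (b s, s)) - dualReal p 0 G) with hg
  have hg_eq : ∀ᶠ s in 𝓝 (0 : ℝ),
      lwFunctional (Matrix.of G) (fun x => s ^ 2 * eval x p) = g s := by
    filter_upwards [hb.coercive, hb.secondMoment] with s h1 h2
    rw [lwFunctional_eq hp hG, dualReal_eq hp h1 h2]
  have h0 := hb.coercive.self_of_nhds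
  have hg0 : g 0 = 0 := by
    simp only [hg]
    rw [← dualReal_eq hp h0 hb.secondMoment.self_of_nhds]
    ring
  have hbc := hb.contDiffAt.continuousAt
  have hgc : ContinuousAt g 0 := by
    have h1 : ContinuousAt (fun s => pairing (b s) G) 0 := by
      have h2 : Continuous fun A : Fin N → Fin N → ℝ => pairing A G := by
        unfold pairing; fun_prop
      exact h2.continuousAt.comp hbc
    have h3 : ContinuousAt (fun s => moment p 1 (b s, s)) 0 :=
      ContinuousAt.comp (f := fun s => (b s, s)) (x := (0 : ℝ))
        (contDiffAt_moment hp 1 (e := (b 0, 0)) h0).continuousAt (hbc.prodMk continuousAt_id)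
    exact (((h1.const_mul _).add (h3.log (moment_one_pos hp (e := (b 0, 0)) h0).ne')).sub
      continuousAt_const).const_mul _
  have ht : Tendsto Real.sqrt (𝓝[>] 0) (𝓝 0) := by
    simpa using (Real.continuous_sqrt.tendsto 0).mono_left nhdsWithin_le_nhds
  have hlim := hgc.tendsto.comp ht
  rw [hg0] at hlim
  refine hlim.congr' ?_
  filter_upwards [ht.eventually hg_eq, self_mem_nhdsWithin] with ε h1 hε
  rw [Function.comp_apply, ← h1, Real.sq_sqrt (le_of_lt hε)]

/-- The derivative in the coupling, from the scaling relation. -/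
lemma hasDerivAt_lwFunctional (hb : IsSmoothSection p G b) (hp : ∀ x, 0 ≤ eval x p)
    (hp4 : p.IsHomogeneous 4) (hG : (Matrix.of G).PosDef) :
    ∀ᶠ ε in 𝓝[>] (0 : ℝ),
      HasDerivAt (fun ε : ℝ => lwFunctional (Matrix.of G) (fun x => ε * eval x p))
        ((∑ ij : Fin N × Fin N, G ij.1 ij.2 *
          selfEnergy (Matrix.of G) (fun x => ε * eval x p) ij.2 ij.1) / (2 * ε)) ε := by
  have ht : Tendsto Real.sqrt (𝓝[>] 0) (𝓝 0) := by
    simpa using (Real.continuous_sqrt.tendsto 0).mono_left nhdsWithin_le_nhds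
  filter_upwards [ht.eventually (hb.coercive.and hb.secondMoment).eventually_nhds,
    ht.eventually (hb.selfEnergy_eq hG), ht.eventually hb.hasFDerivWithinAt,
    ht.eventually hb.symm, self_mem_nhdsWithin] with ε hmom hself hder hsym hε
  have hε : 0 < ε := hε
  set s := √ε with hs
  have hs0 : 0 < s := Real.sqrt_pos.2 hε
  have hs2 : s ^ 2 = ε := Real.sq_sqrt hε.le
  rw [hs2] at hself hder
  -- The curve √(u/ε) G passes through G at u = ε with velocity G/(2ε).
  have hcurve : HasDerivAt (fun u : ℝ => (√u / s) • G) ((1 / (2 * s) / s) • G) ε :=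
    ((Real.hasDerivAt_sqrt hε.ne').div_const s).smul_const G
  have hmem : ∀ u : ℝ, (√u / s) • G ∈ symmArrays N := fun u => by
    have : (Matrix.of G).IsSymm := by ext i j; exact symm_of_posDef hG j i
    exact this.smul (√u / s)
  have hcomp := hder.comp_hasDerivAt_of_eq ε hcurve (Eventually.of_forall hmem)
    (by rw [← hs, div_self hs0.ne', one_smul])
  refine (hcomp.congr_of_eventuallyEq ?_).congr_deriv ?_
  · filter_upwards [(Real.continuous_sqrt.continuousAt (x := ε)).eventually hmom,
      lt_mem_nhds hε] with u hu hu0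
    have hsu : 0 < √u := Real.sqrt_pos.2 hu0
    -- The dilation factor has r² = √u / s, so that r² s = √u: moving the moments along the curve at
    -- coupling ε amounts to changing the coupling to u at fixed `G`.
    have hr : √(√u / s) ^ 2 = √u / s := Real.sq_sqrt (by positivity)
    have hrs : √(√u / s) ^ 2 * s = √u := by rw [hr, div_mul_cancel₀ _ hs0.ne']
    have h := lwFunctional_scaling hp hp4 (r := √(√u / s)) (by positivity) hG (s := s)
      (A := b √u) hu.1 (by rw [hrs]; exact hu.2)
    rw [hrs, hr, Real.sq_sqrt hu0.le, hs2] at h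
    exact h.symm
  · have hsym0 := hb.symm.self_of_nhds
    rw [pairingL_apply, Fintype.sum_prod_type, pairing, Finset.sum_div]
    refine Finset.sum_congr rfl fun i _ => ?_
    rw [Finset.sum_div]
    refine Finset.sum_congr rfl fun j _ => ?_
    rw [hself, hsym j i, hsym0 j i, ← hs2]
    simp only [Pi.smul_apply, Pi.sub_apply, smul_eq_mul]
    field_simp

/-- Term-by-term integration: the coefficients of the Luttinger-Ward functional from those of the
self-energy. -/
lemma isAsymptoticSeries_lwFunctional (hb : IsSmoothSection p G b) (hp : ∀ x, 0 ≤ eval x p)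
    (hp4 : p.IsHomogeneous 4) (hG : (Matrix.of G).PosDef)
    {σ : ℕ → Matrix (Fin N) (Fin N) ℝ} (hσ : ∀ i j, IsAsymptoticSeries
      (fun ε => selfEnergy (Matrix.of G) (fun x => ε * eval x p) i j) fun k => σ k i j) :
    IsAsymptoticSeries (fun ε : ℝ => lwFunctional (Matrix.of G) (fun x => ε * eval x p))
      fun k => 1 / (2 * (k : ℝ)) * (Matrix.of G * σ k).trace := by
  have hT := IsAsymptoticSeries.sum (Finset.univ : Finset (Fin N × Fin N))
    (fun ij => G ij.1 ij.2) fun ij _ => hσ ij.2 ij.1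
  have h := hT.of_hasDerivAt (hb.hasDerivAt_lwFunctional hp hp4 hG) (hb.tendsto_lwFunctional hp hG)
  have htr (k : ℕ) : (Matrix.of G * σ k).trace =
      ∑ ij : Fin N × Fin N, G ij.1 ij.2 * σ k ij.2 ij.1 := by
    simp [Matrix.trace, Matrix.mul_apply, Fintype.sum_prod_type]
  simpa only [htr] using h

end IsSmoothSection

end LuttingerWard

end

theorem proposition4p4 {N : ℕ} (p : MvPolynomial (Fin N) ℝ) (hp : p.IsHomogeneous 4)
    (U : (Fin N → ℝ) → ℝ) (hU : ∀ x, U x = MvPolynomial.eval x p)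
    (hgrowth : LuttingerWard.WeakGrowth U)
    (G : Matrix (Fin N) (Fin N) ℝ) (hG : G.PosDef) :
    -- `ℱ` is finite, so that `Φ` is a genuine real-valued functional
    (∀ G' : Matrix (Fin N) (Fin N) ℝ, G'.PosDef → ∀ ε : ℝ, 0 < ε →
      LuttingerWard.dualFunctional G' (ε • U) ≠ ⊤ ∧
      LuttingerWard.dualFunctional G' (ε • U) ≠ ⊥) ∧
    -- the derivatives that define the self-energy exist for small `ε > 0`
    (∀ᶠ ε : ℝ in 𝓝[>] 0, DifferentiableWithinAt ℝ
      (fun G' : Matrix (Fin N) (Fin N) ℝ => LuttingerWard.lwFunctional G' (ε • U))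
      {G' : Matrix (Fin N) (Fin N) ℝ | G'.IsSymm} G) ∧
    -- both asymptotic series exist
    (∃ φ : ℕ → ℝ, LuttingerWard.IsAsymptoticSeries
      (fun ε => LuttingerWard.lwFunctional G (ε • U)) φ) ∧
    (∃ σ : ℕ → Matrix (Fin N) (Fin N) ℝ, ∀ i j, LuttingerWard.IsAsymptoticSeries
      (fun ε => LuttingerWard.selfEnergy G (ε • U) i j) (fun k => σ k i j)) ∧
    -- and their coefficients are related
    (∀ (φ : ℕ → ℝ) (σ : ℕ → Matrix (Fin N) (Fin N) ℝ),
      LuttingerWard.IsAsymptoticSeries (fun ε => LuttingerWard.lwFunctional G (ε • U)) φ →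
      (∀ i j, LuttingerWard.IsAsymptoticSeries
        (fun ε => LuttingerWard.selfEnergy G (ε • U) i j) (fun k => σ k i j)) →
      ∀ k : ℕ, 1 ≤ k → φ k = 1 / (2 * (k : ℝ)) * (G * σ k).trace) := by
  obtain rfl : U = fun x => MvPolynomial.eval x p := funext hU
  obtain ⟨C, hC⟩ := hgrowth.lower_bound
  have hpos := LuttingerWard.eval_nonneg_of_isHomogeneous hp hC
  obtain ⟨G, rfl⟩ : ∃ G₀, G = Matrix.of G₀ := ⟨Matrix.of.symm G, (Equiv.apply_symm_apply _ _).symm⟩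
  obtain ⟨b, hb⟩ := LuttingerWard.exists_isSmoothSection hpos hG
  have hseries : ∃ σ : ℕ → Matrix (Fin N) (Fin N) ℝ, ∀ i j, LuttingerWard.IsAsymptoticSeries
      (fun ε => LuttingerWard.selfEnergy (Matrix.of G)
        (ε • fun x => MvPolynomial.eval x p) i j) (fun k => σ k i j) := by
    choose c hc using hb.isAsymptoticSeries_selfEnergy hG
    exact ⟨fun k => Matrix.of fun i j => c i j k, hc⟩
  refine ⟨fun G' hG' ε hε => ?_, ?_, ?_, hseries, fun φ σ hφ hσ => ?_⟩
  · obtain ⟨G', rfl⟩ : ∃ G₀, G' = Matrix.of G₀ :=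
      ⟨Matrix.of.symm G', (Equiv.apply_symm_apply _ _).symm⟩
    -- Every coupling ε > 0 is the square of √ε, so finiteness is not restricted to small ε.
    have h := LuttingerWard.dualFunctional_ne_top_bot hpos hG' (√ε)
    rw [Real.sq_sqrt hε.le] at h
    exact h
  · have ht : Tendsto Real.sqrt (𝓝[>] 0) (𝓝 0) := by
      simpa using (Real.continuous_sqrt.tendsto 0).mono_left nhdsWithin_le_nhds
    filter_upwards [ht.eventually hb.hasFDerivWithinAt, self_mem_nhdsWithin] with ε h hε
    rw [Real.sq_sqrt (le_of_lt hε)] at h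
    exact h.differentiableWithinAt
  -- The series for Φ is obtained from that of Σ by integration, so its existence and the
  -- coefficient relation have the same source.
  · obtain ⟨σ, hσ⟩ := hseries
    exact ⟨_, hb.isAsymptoticSeries_lwFunctional hpos hp hG hσ⟩
  · exact hφ.coeff_unique (hb.isAsymptoticSeries_lwFunctional hpos hp hG hσ)
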